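/- A rectilinear drawing of $K_n$ is a placement of its $n$ vertices at distinct points of the plane, no three collinear, with edges drawn as straight segments, such that no three edges meet in a point unless that point is an endpoint of all three. Its number of crossings is the number of pairs of edges whose interiors meet, and $\overline{cr}(K_n)$ is the least number of crossings of a rectilinear drawing of $K_n$. Put $$C_{s3}(n,a)=\tfrac{139}{4212}n^4-\tfrac{23}{216}n^3a+\tfrac16 n^2a^2-\tfrac{13}{72}n^3+\tfrac13 n^2a-\tfrac12 na^2+\tfrac{11}{36}n^2-\tfrac1{24}na-\tfrac{19}{104}n .$$ A point set $S$ docks above (below) a point set $c$ if all points of $S$ lie strictly above (below) every line through two points of $c$. A Singer configuration of order $1$ is a single point; one of order $3k$ is a union $L\cup T\cup R$ of three Singer configurations of order $k$, with all of $L$ to the left of all of $T$ and all of $T$ to the left of all of $R$, such that $T$ lies above every line joining $L$ to $R$, $T$ docks above $L$ and above $R$, $R$ docks below $L$, $L$ docks below $R$, and one of $L,R$ docks above $T$ and the other below $T$. A slid Singer drawing of $K_{3k}$ with parameter $a$ is a rectilinear drawing whose vertex set is a union of clusters $c_0,c_1,c_2$ (indices mod $3$) such that all triples in $c_0\times c_1\times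 c_2$ are counterclockwise, each $c_i$ is an affine image of a Singer configuration of order $k$ (above and below $c_i$ being understood in the coordinates of that configuration), and for each $i$ the cluster $c_{i+2}$ docks above $c_{i+1}$, while $c_i$ is a disjoint union of a part of exactly $a$ points docking below $c_{i+1}$ and a part docking above $c_{i+1}$. Let $n=3^i$ with $i\ge 1$ and $a=\lceil 23n/72-1/24\rceil$. Then there is a slid Singer drawing of $K_n$ with parameter $a$ that has exactly $C_{s3}(n,a)$ crossings. Hence $$\overline{cr}(K_n)\le C_{s3}\bigl(n,\lceil 23n/72-1/24\rceil\bigr).$$ In particular $C_{s3}(81,26)=623916$ and $\overline{cr}(K_{81})\le 623916$. -/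

import Mathlib

/-! Rectilinear drawings of complete graphs, their crossings, and the slid form of Singer's
recursive three-cluster construction. The plane is `ℝ × ℝ`. -/

/-- Twice the signed area of the triangle `p q r`: positive iff `p, q, r` is a counterclockwise
triple. If `p` is to the left of `q`, it is positive iff `r` is strictly above the line `pq`. -/
def orient (p q r : ℝ × ℝ) : ℝ :=
  (q.1 - p.1) * (r.2 - p.2) - (q.2 - p.2) * (r.1 - p.1)

/-- The closed line segment that joins the two ends of an edge, for vertices placed by `pt`. -/
def edgeSegment {V : Type*} (pt : V → ℝ × ℝ) (e : Sym2 V) : Set (ℝ × ℝ) :=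
  Sym2.lift ⟨fun u v => segment ℝ (pt u) (pt v), fun u v => segment_symm ℝ (pt u) (pt v)⟩ e

/-- The relative interior of the segment of an edge. -/
def edgeInterior {V : Type*} (pt : V → ℝ × ℝ) (e : Sym2 V) : Set (ℝ × ℝ) :=
  Sym2.lift ⟨fun u v => openSegment ℝ (pt u) (pt v),
    fun u v => openSegment_symm ℝ (pt u) (pt v)⟩ e

/-- A rectilinear drawing of the complete graph `K_n`: distinct points, no three of them collinear,
such that no three edges meet in a point unless that point is an endpoint of all three. -/
structure RectilinearDrawing (n : ℕ) where
  pt : Fin n → ℝ × ℝ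
  injective : Function.Injective pt
  not_collinear : ∀ u v w : Fin n, u ≠ v → v ≠ w → u ≠ w →
    ¬ Collinear ℝ {pt u, pt v, pt w}
  not_concurrent : ∀ e ∈ (⊤ : SimpleGraph (Fin n)).edgeSet,
    ∀ f ∈ (⊤ : SimpleGraph (Fin n)).edgeSet, ∀ g ∈ (⊤ : SimpleGraph (Fin n)).edgeSet,
    e ≠ f → f ≠ g → e ≠ g →
    ∀ x, x ∈ edgeSegment pt e → x ∈ edgeSegment pt f → x ∈ edgeSegment pt g →
      ∃ v : Fin n, pt v = x ∧ v ∈ e ∧ v ∈ f ∧ v ∈ g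

/-- The number of edge crossings: unordered pairs of distinct edges whose interiors meet. -/
noncomputable def RectilinearDrawing.crossings {n : ℕ} (D : RectilinearDrawing n) : ℕ :=
  Set.ncard {z : Sym2 (Sym2 (Fin n)) |
    ∃ e ∈ (⊤ : SimpleGraph (Fin n)).edgeSet, ∃ f ∈ (⊤ : SimpleGraph (Fin n)).edgeSet,
      z = s(e, f) ∧ e ≠ f ∧ (edgeInterior D.pt e ∩ edgeInterior D.pt f).Nonempty}

/-- The rectilinear crossing number of `K_n`: the fewest crossings over all its rectilinear
drawings. -/
noncomputable def rectilinearCrossingNumber (n : ℕ) : ℕ :=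
  sInf (Set.range fun D : RectilinearDrawing n => D.crossings)

/-- Every point of `S` is strictly above every line through two points of `c`
(`S` docks on the top side of `c`). -/
def DocksAbove (c S : Set (ℝ × ℝ)) : Prop :=
  ∀ p ∈ c, ∀ q ∈ c, p.1 < q.1 → ∀ r ∈ S, 0 < orient p q r

/-- Every point of `S` is strictly below every line through two points of `c`
(`S` docks on the bottom side of `c`). -/
def DocksBelow (c S : Set (ℝ × ℝ)) : Prop :=
  ∀ p ∈ c, ∀ q ∈ c, p.1 < q.1 → ∀ r ∈ S, orient p q r < 0

/-- `IsSinger j c`: `c` is an upward pointing recursive three-cluster configuration of `3 ^ j`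
points. For `j = 0` it is a single point. Otherwise it consists of a left, a top and a right
cluster, placed from left to right, each of them such a configuration of order `3 ^ (j - 1)`
and so flat that the other two clusters dock at it from opposite sides; the top cluster is above
all lines from the left to the right cluster. -/
def IsSinger : ℕ → Set (ℝ × ℝ) → Prop
  | 0, c => ∃ p, c = {p}
  | j + 1, c => ∃ L T R : Set (ℝ × ℝ),
      c = L ∪ T ∪ R ∧ IsSinger j L ∧ IsSinger j T ∧ IsSinger j R ∧
      (∀ l ∈ L, ∀ t ∈ T, l.1 < t.1) ∧ (∀ t ∈ T, ∀ r ∈ R, t.1 < r.1) ∧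
      (∀ l ∈ L, ∀ t ∈ T, ∀ r ∈ R, 0 < orient l r t) ∧
      (DocksAbove L T ∧ DocksBelow L R) ∧
      (DocksAbove R T ∧ DocksBelow R L) ∧
      ((DocksAbove T L ∧ DocksBelow T R) ∨ (DocksAbove T R ∧ DocksBelow T L))

/-- `IsSlidSinger j a V`: the point set `V` arises by sliding all three clusters of a three-cluster
configuration. It consists of three clusters `c 0`, `c 1`, `c 2` in counterclockwise order
(no line through points of two of them separates points of the third). Each is an affine image of
a configuration `IsSinger j`, in whose frame (the map `φ i`) top and bottom of `c i` are read off.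
The cluster `c (i + 2)` docks entirely on the top of `c (i + 1)`, while `c i` splits into a part
`A i` of exactly `a` points, which docks on the bottom of `c (i + 1)`, and the remaining part `B i`,
which has been slid over to the top of `c (i + 1)`. -/
def IsSlidSinger (j a : ℕ) (V : Set (ℝ × ℝ)) : Prop :=
  ∃ (c A B : Fin 3 → Set (ℝ × ℝ)) (φ : Fin 3 → (ℝ × ℝ) ≃ᵃ[ℝ] (ℝ × ℝ)),
    V = ⋃ i, c i ∧
    (∀ p ∈ c 0, ∀ q ∈ c 1, ∀ r ∈ c 2, 0 < orient p q r) ∧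
    ∀ i : Fin 3,
      IsSinger j (φ i '' c i) ∧
      c i = A i ∪ B i ∧ Disjoint (A i) (B i) ∧ (A i).ncard = a ∧
      DocksAbove (φ (i + 1) '' c (i + 1)) (φ (i + 1) '' c (i + 2)) ∧
      DocksAbove (φ (i + 1) '' c (i + 1)) (φ (i + 1) '' B i) ∧
      DocksBelow (φ (i + 1) '' c (i + 1)) (φ (i + 1) '' A i)

/-- The explicit crossing count `C_{s3}(n, a)` of the construction with three slid clusters. -/
def Cs3 (n a : ℚ) : ℚ :=
  139 / 4212 * n ^ 4 - 23 / 216 * n ^ 3 * a + 1 / 6 * n ^ 2 * a ^ 2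
    - 13 / 72 * n ^ 3 + 1 / 3 * n ^ 2 * a - 1 / 2 * n * a ^ 2
    + 11 / 36 * n ^ 2 - 1 / 24 * n * a - 19 / 104 * n

/-!
The crossings of a rectilinear drawing are the convex quadrilaterals among its vertices, and these
can be counted from the numbers `L(p, q)` of vertices to the left of the directed lines `p q`. There
are three ways to split four points into two pairs. If the points are not in convex position, then
for each splitting exactly one of the two lines separates the other pair; otherwise both lines do so
for one splitting (the crossing diagonals) and none for the other two. Hence
`8 * crossings = n (n - 1) (n - 2) (n - 3) - 4 ∑ L(p, q) L(q, p)`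
(`RectilinearDrawing.crossings_eq`), where the sum is over ordered pairs (`separations`).

For a union of three clusters of `k` points that dock at each other this sum is explicit
(`ThreeClusters.separations_eq`). A line inside a cluster has the other clusters on known sides.
For a line from `p` in one cluster to `q` in the next one, the third cluster is on one side, and the
points of the cluster of `p` to its left are those that precede `p` in the order of the cluster, up
to reversal, and likewise for `q`; so only sums over ranks `0, …, k - 1` occur. Besides the sums of
the single clusters, the formula contains the number of points above the lines of a cluster
(`upperCount`). In a Singer configuration both quantities satisfy linear recursions, solved in
`SingerFamily.separations_eq` and `SingerFamily.upperCount_eq`. All these counts depend only on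
the orientations prescribed by the docking conditions, so every slid configuration has
`Cs3 n a` crossings (`SlidFamily.separations_eq`).

It remains to construct one. Singer configurations are obtained by placing small flattened copies of
a smaller one at the corners of a triangle (`exists_singerFamily`). For the slid configuration, a
Singer configuration is translated horizontally so that exactly `a` of its points are to the right
of the vertical axis (`exists_threshold`); flat copies of it are placed at the corners of a triangle
so that the axis of each cluster goes through the corner of the third one and cuts it in the prescribed
way (`exists_slidFamily_of_fst_ne_zero`). All conditions are strict inequalities, hence stable under
small perturbations (`SlidFamily.eventually`). The concurrency of three edges without common
vertices is a nontrivial polynomial equation in the coordinates, so that a perturbation avoids it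
(`exists_not_concurrent`).
-/

/-! ### Orientation of triples -/

theorem orient_swap (p q r : ℝ × ℝ) : orient q p r = -orient p q r := by
  unfold orient; ring

theorem orient_rotate (p q r : ℝ × ℝ) : orient q r p = orient p q r := by
  unfold orient; ring

@[simp] theorem orient_self_left (p r : ℝ × ℝ) : orient p p r = 0 := by
  unfold orient; ring

@[simp] theorem orient_self_right (p q : ℝ × ℝ) : orient p q q = 0 := by
  unfold orient; ring

@[simp] theorem orient_self_outer (p q : ℝ × ℝ) : orient p q p = 0 := by
  unfold orient; ring

/-- The linear relation between the areas of the four triangles spanned by four points. It is the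
only fact about the plane that the count of convex quadrilaterals uses. -/
theorem orient_four (p q r s : ℝ × ℝ) :
    orient p q r - orient p q s + orient p r s - orient q r s = 0 := by
  unfold orient; ring

theorem orient_combo {a b : ℝ} (hab : a + b = 1) (p q r s : ℝ × ℝ) :
    orient r s (a • p + b • q) = a * orient r s p + b * orient r s q := by
  obtain rfl : a = 1 - b := by linarith
  simp only [orient, Prod.fst_add, Prod.snd_add, Prod.smul_fst, Prod.smul_snd, smul_eq_mul]
  ring

/-- A family of points no three of which are collinear. -/
def GeneralPosition {ι : Type*} (f : ι → ℝ × ℝ) : Prop :=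
  ∀ u v w, u ≠ v → v ≠ w → u ≠ w → orient (f u) (f v) (f w) ≠ 0

theorem orient_eq_zero_of_collinear {p q r : ℝ × ℝ} (h : Collinear ℝ {p, q, r}) :
    orient p q r = 0 := by
  rw [collinear_iff_of_mem (p₀ := p) (by simp)] at h
  obtain ⟨v, hv⟩ := h
  obtain ⟨a, rfl⟩ := hv q (by simp)
  obtain ⟨b, rfl⟩ := hv r (by simp)
  simp only [orient, vadd_eq_add, Prod.fst_add, Prod.snd_add, Prod.smul_fst, Prod.smul_snd,
    smul_eq_mul]
  ring

theorem orient_eq_zero_of_mem_segment {p q x : ℝ × ℝ} (h : x ∈ segment ℝ p q) :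
    orient p q x = 0 := by
  obtain ⟨a, b, -, -, hab, rfl⟩ := h
  rw [orient_combo hab]; simp

theorem GeneralPosition.injective {ι : Type*} [Fintype ι] {f : ι → ℝ × ℝ}
    (h : GeneralPosition f) (hc : 3 ≤ Fintype.card ι) : Function.Injective f := by
  classical
  intro u v huv
  by_contra hne
  obtain ⟨w, -, hw⟩ := Finset.exists_mem_notMem_of_card_lt_card
    (s := {u, v}) (t := Finset.univ)
    (lt_of_le_of_lt Finset.card_le_two (by rw [Finset.card_univ]; omega))
  simp only [Finset.mem_insert, Finset.mem_singleton, not_or] at hw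
  exact h u v w hne (Ne.symm hw.2) (Ne.symm hw.1) (by rw [huv]; simp)

/-! ### Crossings and separated pairs -/

/-- The segments `p q` and `r s` cross, expressed by orientations: each line separates the
endpoints of the other segment. -/
def Crosses (p q r s : ℝ × ℝ) : Prop :=
  orient p q r * orient p q s < 0 ∧ orient r s p * orient r s q < 0

theorem openSegment_inter_nonempty_of_crosses {p q r s : ℝ × ℝ} (h : Crosses p q r s) :
    (openSegment ℝ p q ∩ openSegment ℝ r s).Nonempty := by
  have weights : ∀ x y : ℝ, x * y < 0 →
      0 < y / (y - x) ∧ 0 < -x / (y - x) ∧ y / (y - x) + -x / (y - x) = 1 := by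
    intro x y hxy
    rcases mul_neg_iff.1 hxy with ⟨hx, hy⟩ | ⟨hx, hy⟩
    · refine ⟨div_pos_of_neg_of_neg hy (by linarith),
        div_pos_of_neg_of_neg (by linarith) (by linarith), ?_⟩
      rw [← add_div, div_eq_one_iff_eq (by linarith)]; ring
    · refine ⟨div_pos hy (by linarith), div_pos (by linarith) (by linarith), ?_⟩
      rw [← add_div, div_eq_one_iff_eq (by linarith)]; ring
  obtain ⟨a1, b1, ab1⟩ := weights _ _ h.1
  obtain ⟨a2, b2, ab2⟩ := weights _ _ h.2
  have hne1 : orient p q s - orient p q r ≠ 0 := fun h0 => by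
    rw [h0] at a1; simp at a1
  have hne2 : orient r s q - orient r s p ≠ 0 := fun h0 => by
    rw [h0] at a2; simp at a2
  refine ⟨_, ⟨_, _, a2, b2, ab2, rfl⟩, ⟨_, _, a1, b1, ab1, ?_⟩⟩
  ext
  · simp only [Prod.fst_add, Prod.smul_fst, smul_eq_mul]
    field_simp
    unfold orient; ring
  · simp only [Prod.snd_add, Prod.smul_snd, smul_eq_mul]
    field_simp
    unfold orient; ring

/-- If two distinct edges with vertices in general position have interior points in common, then
the line of each of them separates the endpoints of the other. -/
theorem mul_orient_neg_of_openSegment_inter {ι : Type*} {f : ι → ℝ × ℝ} (hf : GeneralPosition f)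
    {p q r s : ι} (hpq : p ≠ q) (hrs : r ≠ s) (hne : s(p, q) ≠ s(r, s))
    (h : (openSegment ℝ (f p) (f q) ∩ openSegment ℝ (f r) (f s)).Nonempty) :
    orient (f r) (f s) (f p) * orient (f r) (f s) (f q) < 0 := by
  obtain ⟨x, ⟨a, b, ha, hb, hab, rfl⟩, hx⟩ := h
  have h0 := orient_eq_zero_of_mem_segment (openSegment_subset_segment _ _ _ hx)
  rw [orient_combo hab] at h0
  have key : orient (f r) (f s) (f p) ≠ 0 ∨ orient (f r) (f s) (f q) ≠ 0 := by
    by_contra! hcon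
    have hp : p = r ∨ p = s := by
      by_contra! hp
      exact hf r s p hrs hp.2.symm hp.1.symm hcon.1
    have hq : q = r ∨ q = s := by
      by_contra! hq
      exact hf r s q hrs hq.2.symm hq.1.symm hcon.2
    rcases hp with rfl | rfl <;> rcases hq with rfl | rfl <;> simp_all [Sym2.eq_swap]
  rcases lt_trichotomy (orient (f r) (f s) (f p)) 0 with hp | hp | hp
  · exact mul_neg_of_neg_of_pos hp (by nlinarith [mul_neg_of_pos_of_neg ha hp])
  · rw [hp] at h0 key
    simp [hb.ne'] at h0
    simp [h0] at key
  · exact mul_neg_of_pos_of_neg hp (by nlinarith [mul_pos ha hp])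

theorem openSegment_inter_nonempty_iff_crosses {ι : Type*} {f : ι → ℝ × ℝ}
    (hf : GeneralPosition f) {p q r s : ι} (hpq : p ≠ q) (hrs : r ≠ s) (hne : s(p, q) ≠ s(r, s)) :
    (openSegment ℝ (f p) (f q) ∩ openSegment ℝ (f r) (f s)).Nonempty ↔
      Crosses (f p) (f q) (f r) (f s) :=
  ⟨fun h => ⟨mul_orient_neg_of_openSegment_inter hf hrs hpq hne.symm (by rwa [Set.inter_comm]),
    mul_orient_neg_of_openSegment_inter hf hpq hrs hne h⟩, openSegment_inter_nonempty_of_crosses⟩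

/-- A symmetric irreflexive relation has twice as many ordered as unordered pairs. -/
theorem card_eq_two_mul_card_image_sym2 {α : Type*} [DecidableEq α] (S : Finset (α × α))
    (hsymm : ∀ x y, (x, y) ∈ S → (y, x) ∈ S) (hirr : ∀ x, (x, x) ∉ S) :
    S.card = 2 * (S.image fun z => s(z.1, z.2)).card := by
  rw [mul_comm, Finset.card_eq_sum_card_image (fun z : α × α => s(z.1, z.2)) S]
  refine Finset.sum_const_nat fun z hz => ?_
  obtain ⟨⟨x, y⟩, hxy, rfl⟩ := Finset.mem_image.1 hz
  have : (S.filter fun w => s(w.1, w.2) = s(x, y)) = {(x, y), (y, x)} := by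
    ext ⟨u, v⟩
    simp only [Finset.mem_filter, Sym2.eq_iff, Finset.mem_insert, Finset.mem_singleton,
      Prod.mk.injEq]
    constructor
    · exact fun h => h.2
    · rintro (⟨rfl, rfl⟩ | ⟨rfl, rfl⟩)
      · exact ⟨hxy, Or.inl ⟨rfl, rfl⟩⟩
      · exact ⟨hsymm _ _ hxy, Or.inr ⟨rfl, rfl⟩⟩
  rw [this, Finset.card_pair]
  rintro h
  obtain rfl : x = y := (Prod.mk.injEq _ _ _ _ ▸ h).1
  exact hirr x hxy

theorem ne_of_crosses {ι : Type*} {f : ι → ℝ × ℝ} {p q r s : ι}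
    (h : Crosses (f p) (f q) (f r) (f s)) : p ≠ q ∧ r ≠ s ∧ s(p, q) ≠ s(r, s) := by
  obtain ⟨h1, h2⟩ := h
  refine ⟨?_, ?_, ?_⟩
  · rintro rfl; simp at h1
  · rintro rfl; simp at h2
  · intro h
    rcases Sym2.eq_iff.1 h with ⟨rfl, rfl⟩ | ⟨rfl, rfl⟩ <;> simp at h1

open Classical in
/-- Every crossing is described by eight ordered quadruples of vertices. -/
theorem RectilinearDrawing.eight_mul_crossings {n : ℕ} (D : RectilinearDrawing n)
    (hD : GeneralPosition D.pt) :
    8 * D.crossings = (Finset.univ.filter fun z : (Fin n × Fin n) × (Fin n × Fin n) =>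
      Crosses (D.pt z.1.1) (D.pt z.1.2) (D.pt z.2.1) (D.pt z.2.2)).card := by
  -- ordered pairs of crossing edges
  set E : Finset (Sym2 (Fin n) × Sym2 (Fin n)) := Finset.univ.filter fun z =>
    z.1 ∈ (⊤ : SimpleGraph (Fin n)).edgeSet ∧ z.2 ∈ (⊤ : SimpleGraph (Fin n)).edgeSet ∧
      z.1 ≠ z.2 ∧ (edgeInterior D.pt z.1 ∩ edgeInterior D.pt z.2).Nonempty with hE
  have h1 : E.card = 2 * D.crossings := by
    rw [card_eq_two_mul_card_image_sym2 E, RectilinearDrawing.crossings,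
      ← Set.ncard_coe_finset]
    · congr 2
      ext z
      simp only [hE, Finset.coe_image, Finset.coe_filter, Finset.mem_univ, true_and,
        Set.mem_image, Set.mem_ofPred_eq, Prod.exists]
      constructor
      · rintro ⟨e, f, ⟨he, hf, hne, h⟩, rfl⟩
        exact ⟨e, he, f, hf, rfl, hne, h⟩
      · rintro ⟨e, he, f, hf, rfl, hne, h⟩
        exact ⟨e, f, ⟨he, hf, hne, h⟩, rfl⟩
    · intro e f
      simp only [hE, Finset.mem_filter, Finset.mem_univ, true_and]
      rintro ⟨he, hf, hne, h⟩
      exact ⟨hf, he, hne.symm, by rwa [Set.inter_comm]⟩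
    · intro e
      simp [hE]
  rw [show 8 * D.crossings = 4 * E.card by omega, mul_comm,
    Finset.card_eq_sum_card_fiberwise (f := fun z : (Fin n × Fin n) × (Fin n × Fin n) =>
      (s(z.1.1, z.1.2), s(z.2.1, z.2.2))) (t := E)]
  · symm
    refine Finset.sum_const_nat ?_
    rintro ⟨e, f⟩ hef
    induction e using Sym2.ind with | _ p q => ?_
    induction f using Sym2.ind with | _ r s => ?_
    simp only [hE, Finset.mem_filter, Finset.mem_univ, true_and, SimpleGraph.mem_edgeSet,
      SimpleGraph.top_adj] at hef
    obtain ⟨hpq, hrs, hne, h⟩ := hef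
    have hc := (openSegment_inter_nonempty_iff_crosses hD hpq hrs hne).1 h
    have : (Finset.univ.filter fun z : (Fin n × Fin n) × (Fin n × Fin n) =>
        Crosses (D.pt z.1.1) (D.pt z.1.2) (D.pt z.2.1) (D.pt z.2.2)).filter
          (fun z => (s(z.1.1, z.1.2), s(z.2.1, z.2.2)) = (s(p, q), s(r, s))) =
        ({(p, q), (q, p)} : Finset _) ×ˢ ({(r, s), (s, r)} : Finset _) := by
      ext ⟨⟨a, b⟩, c, d⟩
      simp only [Finset.mem_filter, Finset.mem_univ, true_and, Prod.mk.injEq, Sym2.eq_iff,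
        Finset.mem_product, Finset.mem_insert, Finset.mem_singleton]
      refine ⟨fun h => h.2, fun h => ⟨?_, h⟩⟩
      obtain ⟨h1, h2⟩ := hc
      rcases h with ⟨⟨rfl, rfl⟩ | ⟨rfl, rfl⟩, ⟨rfl, rfl⟩ | ⟨rfl, rfl⟩⟩
      · exact ⟨h1, h2⟩
      · refine ⟨by linarith, ?_⟩
        rw [orient_swap (D.pt d), orient_swap (D.pt d)]; linarith
      · refine ⟨?_, by linarith⟩
        rw [orient_swap (D.pt b), orient_swap (D.pt b)]; linarith
      · refine ⟨?_, ?_⟩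
        · rw [orient_swap (D.pt b), orient_swap (D.pt b)]; linarith
        · rw [orient_swap (D.pt d), orient_swap (D.pt d)]; linarith
    rw [this, Finset.card_product, Finset.card_pair, Finset.card_pair]
    · simpa using fun h : r = s => absurd h hrs
    · simpa using fun h : p = q => absurd h hpq
  · rintro ⟨⟨p, q⟩, r, s⟩ hz
    have hc : Crosses (D.pt p) (D.pt q) (D.pt r) (D.pt s) := by simpa using hz
    obtain ⟨hpq, hrs, hne⟩ := ne_of_crosses hc
    simp only [hE, Finset.coe_filter, Finset.mem_univ, true_and, Set.mem_ofPred_eq,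
      SimpleGraph.mem_edgeSet, SimpleGraph.top_adj]
    exact ⟨hpq, hrs, hne, (openSegment_inter_nonempty_iff_crosses hD hpq hrs hne).2 hc⟩

/-- The number of points of the family to the left of the directed line from `f p` to `f q`. -/
noncomputable def leftCount {ι : Type*} [Fintype ι] (f : ι → ℝ × ℝ) (p q : ι) : ℚ :=
  ∑ r, if 0 < orient (f p) (f q) (f r) then 1 else 0

/-- The number of quadruples `(p, q, r, s)` such that `r` is to the left and `s` to the right of the
directed line from `f p` to `f q`. -/
noncomputable def separations {ι : Type*} [Fintype ι] (f : ι → ℝ × ℝ) : ℚ :=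
  ∑ p, ∑ q, leftCount f p q * leftCount f q p

theorem leftCount_comp_equiv {ι κ : Type*} [Fintype ι] [Fintype κ] (e : κ ≃ ι) (f : ι → ℝ × ℝ)
    (p q : κ) : leftCount (f ∘ e) p q = leftCount f (e p) (e q) :=
  Equiv.sum_comp e fun r => if 0 < orient (f (e p)) (f (e q)) (f r) then (1 : ℚ) else 0

theorem separations_comp_equiv {ι κ : Type*} [Fintype ι] [Fintype κ] (e : κ ≃ ι)
    (f : ι → ℝ × ℝ) : separations (f ∘ e) = separations f := by
  simp only [separations, leftCount_comp_equiv]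
  rw [← Equiv.sum_comp e]
  exact Finset.sum_congr rfl fun p _ =>
    Equiv.sum_comp e fun q => leftCount f (e p) q * leftCount f q (e p)

@[simp] theorem leftCount_self {ι : Type*} [Fintype ι] (f : ι → ℝ × ℝ) (p : ι) :
    leftCount f p p = 0 := by
  simp [leftCount]

/-- Every further point is to the left or to the right of a line through two points. -/
theorem GeneralPosition.leftCount_add {ι : Type*} [Fintype ι] {f : ι → ℝ × ℝ}
    (hf : GeneralPosition f) {p q : ι} (hpq : p ≠ q) :
    leftCount f p q + leftCount f q p = Fintype.card ι - 2 := by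
  classical
  have h : ∀ r, ((if 0 < orient (f p) (f q) (f r) then 1 else 0) +
      (if 0 < orient (f q) (f p) (f r) then 1 else 0) : ℚ) =
      1 - (if r = p then 1 else 0) - (if r = q then 1 else 0) := by
    intro r
    rw [orient_swap (f p) (f q)]
    by_cases hp : r = p
    · subst hp; simp [hpq]
    by_cases hq : r = q
    · subst hq; simp [hp]
    rcases lt_or_gt_of_ne (hf p q r hpq (Ne.symm hq) (Ne.symm hp)) with h | h <;>
      simp [hp, hq, h, h.le]
  rw [leftCount, leftCount, ← Finset.sum_add_distrib, Finset.sum_congr rfl fun r _ => h r]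
  simp only [Finset.sum_sub_distrib, Finset.sum_ite_eq', Finset.mem_univ, if_true]
  simp
  ring

section Quadruples

variable {ι : Type*} [Fintype ι]

theorem sum_four_swap_outer (F : ι → ι → ι → ι → ℚ) :
    ∑ a, ∑ b, ∑ c, ∑ d, F b a c d = ∑ a, ∑ b, ∑ c, ∑ d, F a b c d :=
  Finset.sum_comm

theorem sum_four_swap_middle (F : ι → ι → ι → ι → ℚ) :
    ∑ a, ∑ b, ∑ c, ∑ d, F a c b d = ∑ a, ∑ b, ∑ c, ∑ d, F a b c d :=
  Finset.sum_congr rfl fun _ _ => Finset.sum_comm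

theorem sum_four_swap_inner (F : ι → ι → ι → ι → ℚ) :
    ∑ a, ∑ b, ∑ c, ∑ d, F a b d c = ∑ a, ∑ b, ∑ c, ∑ d, F a b c d :=
  Finset.sum_congr rfl fun _ _ => Finset.sum_congr rfl fun _ _ => Finset.sum_comm

theorem sum_four_swap_pairs (F : ι → ι → ι → ι → ℚ) :
    ∑ a, ∑ b, ∑ c, ∑ d, F c d a b = ∑ a, ∑ b, ∑ c, ∑ d, F a b c d := by
  rw [sum_four_swap_middle fun a b c d => F b d a c,
    sum_four_swap_outer fun a b c d => F a d b c,
    sum_four_swap_inner fun a b c d => F a c b d, sum_four_swap_middle F]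

/-- In a sum over all quadruples, the three pairings of a quadruple contribute equally. -/
theorem sum_four_pairings (F : ι → ι → ι → ι → ℚ) :
    ∑ a, ∑ b, ∑ c, ∑ d, (F a b c d + F a c b d + F a d b c) =
      3 * ∑ a, ∑ b, ∑ c, ∑ d, F a b c d := by
  simp only [Finset.sum_add_distrib]
  rw [sum_four_swap_middle F, sum_four_swap_inner fun a b c d => F a c b d, sum_four_swap_middle F]
  ring

open Classical in
theorem sum_four_distinct :
    ∑ a : ι, ∑ b : ι, ∑ c : ι, ∑ d : ι,
      (if (a ≠ b ∧ (c ≠ a ∧ c ≠ b) ∧ (d ≠ a ∧ d ≠ b ∧ d ≠ c)) then (1 : ℚ) else 0) =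
      Fintype.card ι * (Fintype.card ι - 1) * (Fintype.card ι - 2) * (Fintype.card ι - 3) := by
  have one : ∀ s : Finset ι, ∑ d : ι, (if d ∉ s then (1 : ℚ) else 0) = Fintype.card ι - s.card := by
    intro s
    rw [← Finset.sum_filter, Finset.sum_const, nsmul_eq_mul, mul_one, Finset.filter_notMem_eq_sdiff,
      Finset.card_sdiff_of_subset (Finset.subset_univ s), Finset.card_univ,
      Nat.cast_sub (Finset.card_le_univ s)]
  have h3 : ∀ a b c : ι, a ≠ b → (c ≠ a ∧ c ≠ b) →
      ∑ d : ι, (if (d ≠ a ∧ d ≠ b ∧ d ≠ c) then (1 : ℚ) else 0) = Fintype.card ι - 3 := by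
    intro a b c hab hc
    have := one {a, b, c}
    rw [Finset.card_eq_three.2 ⟨a, b, c, hab, hc.1.symm, hc.2.symm, rfl⟩] at this
    simpa [not_or] using this
  have h2 : ∀ a b : ι, a ≠ b →
      ∑ c : ι, (if (c ≠ a ∧ c ≠ b) then (1 : ℚ) else 0) = Fintype.card ι - 2 := by
    intro a b hab
    have := one {a, b}
    rw [Finset.card_pair hab] at this
    simpa [not_or] using this
  have h1 : ∀ a : ι, ∑ b : ι, (if a ≠ b then (1 : ℚ) else 0) = Fintype.card ι - 1 := by
    intro a
    have := one {a}
    simpa [eq_comm] using this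
  have e3 : ∀ a b c : ι, ∑ d : ι,
      (if (a ≠ b ∧ (c ≠ a ∧ c ≠ b) ∧ (d ≠ a ∧ d ≠ b ∧ d ≠ c)) then (1 : ℚ) else 0) =
      (if a ≠ b then 1 else 0) * ((if (c ≠ a ∧ c ≠ b) then 1 else 0) * (Fintype.card ι - 3)) := by
    intro a b c
    by_cases hab : a ≠ b
    · by_cases hc : c ≠ a ∧ c ≠ b
      · rw [if_pos hab, if_pos hc, ← h3 a b c hab hc]; simp [hab, hc.1, hc.2]
      · simp [hc]
    · simp [hab]
  have e2 : ∀ a b : ι, (if a ≠ b then (1 : ℚ) else 0) *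
      ((∑ c : ι, if (c ≠ a ∧ c ≠ b) then 1 else 0) * (Fintype.card ι - 3)) =
      (if a ≠ b then 1 else 0) * ((Fintype.card ι - 2) * (Fintype.card ι - 3)) := by
    intro a b
    by_cases hab : a ≠ b
    · rw [h2 a b hab]
    · simp [hab]
  simp only [e3, ← Finset.mul_sum, ← Finset.sum_mul, e2, h1]
  simp
  ring

end Quadruples

/-- The sign computation behind `GeneralPosition.pairings_eq`: `A`, `B`, `C`, `D` are the
orientations of the four triples of four points. -/
theorem separations_of_four {A B C D : ℝ} (rel : A - B + C - D = 0) (hA : A ≠ 0) (hB : B ≠ 0)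
    (hC : C ≠ 0) (hD : D ≠ 0) :
    (((if A * B < 0 then 1 else 0) + (if C * D < 0 then 1 else 0) +
        (if A * B < 0 then 1 else 0) * (if C * D < 0 then 1 else 0)) +
      ((if -A * C < 0 then 1 else 0) + (if B * -D < 0 then 1 else 0) +
        (if -A * C < 0 then 1 else 0) * (if B * -D < 0 then 1 else 0)) +
      ((if -B * -C < 0 then 1 else 0) + (if A * D < 0 then 1 else 0) +
        (if -B * -C < 0 then 1 else 0) * (if A * D < 0 then 1 else 0)) : ℚ) = 3 := by
  rcases lt_or_gt_of_ne hA with h1 | h1 <;> rcases lt_or_gt_of_ne hB with h2 | h2 <;>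
  rcases lt_or_gt_of_ne hC with h3 | h3 <;> rcases lt_or_gt_of_ne hD with h4 | h4 <;>
  first
  | (exfalso; linarith)
  | (simp only [neg_mul, mul_neg, neg_neg, neg_lt_zero, mul_neg_iff, mul_pos_iff, h1, h2, h3, h4,
      h1.not_gt, h2.not_gt, h3.not_gt, h4.not_gt, and_true, and_false, or_true, or_false,
      if_true, if_false]
     norm_num)

theorem separations_of_degenerate_four {A B C D : ℝ} (rel : A - B + C - D = 0)
    (h : (A = 0 ∧ B = 0) ∨ (A = 0 ∧ C = 0) ∨ (A = 0 ∧ D = 0) ∨ (B = 0 ∧ C = 0) ∨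
      (B = 0 ∧ D = 0) ∨ (C = 0 ∧ D = 0)) :
    (((if A * B < 0 then 1 else 0) + (if C * D < 0 then 1 else 0) +
        (if A * B < 0 then 1 else 0) * (if C * D < 0 then 1 else 0)) +
      ((if -A * C < 0 then 1 else 0) + (if B * -D < 0 then 1 else 0) +
        (if -A * C < 0 then 1 else 0) * (if B * -D < 0 then 1 else 0)) +
      ((if -B * -C < 0 then 1 else 0) + (if A * D < 0 then 1 else 0) +
        (if -B * -C < 0 then 1 else 0) * (if A * D < 0 then 1 else 0)) : ℚ) = 0 := by
  rcases h with ⟨rfl, rfl⟩ | ⟨rfl, rfl⟩ | ⟨rfl, rfl⟩ | ⟨rfl, rfl⟩ | ⟨rfl, rfl⟩ | ⟨rfl, rfl⟩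
  · obtain rfl : C = D := by linarith
    simp [mul_self_nonneg]
  · obtain rfl : B = -D := by linarith
    simp [mul_self_nonneg]
  · obtain rfl : B = C := by linarith
    simp [mul_self_nonneg]
  · obtain rfl : A = D := by linarith
    simp [mul_self_nonneg]
  · obtain rfl : A = -C := by linarith
    simp [mul_self_nonneg]
  · obtain rfl : A = B := by linarith
    simp [mul_self_nonneg]

open Classical in
/-- Among the three pairings of four points in convex position, one consists of the two crossing
diagonals and in the other two neither line separates the other pair. If one point is inside the
triangle of the others, then in each pairing exactly one line separates the other pair. -/
theorem GeneralPosition.pairings_eq {ι : Type*} {f : ι → ℝ × ℝ} (hf : GeneralPosition f)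
    (F : ι → ι → ι → ι → ℚ)
    (hF : ∀ a b c d, F a b c d =
      (if orient (f a) (f b) (f c) * orient (f a) (f b) (f d) < 0 then 1 else 0) +
      (if orient (f c) (f d) (f a) * orient (f c) (f d) (f b) < 0 then 1 else 0) +
      (if Crosses (f a) (f b) (f c) (f d) then 1 else 0)) (a b c d : ι) :
    F a b c d + F a c b d + F a d b c =
      3 * if (a ≠ b ∧ (c ≠ a ∧ c ≠ b) ∧ (d ≠ a ∧ d ≠ b ∧ d ≠ c)) then 1 else 0 := by
  have rel := orient_four (f a) (f b) (f c) (f d)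
  have hC : ∀ a b c d, (if Crosses (f a) (f b) (f c) (f d) then (1 : ℚ) else 0) =
      (if orient (f a) (f b) (f c) * orient (f a) (f b) (f d) < 0 then 1 else 0) *
      (if orient (f c) (f d) (f a) * orient (f c) (f d) (f b) < 0 then 1 else 0) := by
    intro a b c d
    rw [ite_zero_mul_ite_zero, one_mul]
    exact if_congr Iff.rfl rfl rfl
  simp only [hF, hC]
  rw [show orient (f c) (f d) (f a) = orient (f a) (f c) (f d) from orient_rotate _ _ _,
    show orient (f c) (f d) (f b) = orient (f b) (f c) (f d) from orient_rotate _ _ _,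
    show orient (f a) (f c) (f b) = -orient (f a) (f b) (f c) by
      rw [orient_rotate (f b), orient_swap],
    show orient (f b) (f d) (f a) = orient (f a) (f b) (f d) from orient_rotate _ _ _,
    show orient (f b) (f d) (f c) = -orient (f b) (f c) (f d) by
      rw [orient_rotate (f c), orient_swap],
    show orient (f a) (f d) (f b) = -orient (f a) (f b) (f d) by
      rw [orient_rotate (f b), orient_swap],
    show orient (f a) (f d) (f c) = -orient (f a) (f c) (f d) by
      rw [orient_rotate (f c), orient_swap],
    show orient (f b) (f c) (f a) = orient (f a) (f b) (f c) from orient_rotate _ _ _]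
  by_cases hd : (a ≠ b ∧ (c ≠ a ∧ c ≠ b) ∧ (d ≠ a ∧ d ≠ b ∧ d ≠ c))
  · rw [if_pos hd, mul_one]
    obtain ⟨hab, ⟨hca, hcb⟩, hda, hdb, hdc⟩ := hd
    exact separations_of_four rel (hf a b c hab hcb.symm hca.symm) (hf a b d hab hdb.symm hda.symm)
      (hf a c d hca.symm hdc.symm hda.symm) (hf b c d hcb.symm hdc.symm hdb.symm)
  · rw [if_neg hd, mul_zero]
    refine separations_of_degenerate_four rel ?_
    by_cases hab : a = b
    · subst hab; simp
    by_cases hca : c = a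
    · subst hca; simp
    by_cases hcb : c = b
    · subst hcb; simp
    by_cases hda : d = a
    · subst hda; simp
    by_cases hdb : d = b
    · subst hdb; simp
    by_cases hdc : d = c
    · subst hdc; simp
    exact absurd ⟨hab, ⟨hca, hcb⟩, hda, hdb, hdc⟩ hd

open Classical in
theorem sum_separated {ι : Type*} [Fintype ι] (f : ι → ℝ × ℝ) :
    ∑ a, ∑ b, ∑ c, ∑ d,
      (if orient (f a) (f b) (f c) * orient (f a) (f b) (f d) < 0 then (1 : ℚ) else 0) =
      2 * separations f := by
  rw [separations, Finset.mul_sum]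
  refine Finset.sum_congr rfl fun a _ => ?_
  rw [Finset.mul_sum]
  refine Finset.sum_congr rfl fun b _ => ?_
  have h : ∀ c d, (if orient (f a) (f b) (f c) * orient (f a) (f b) (f d) < 0 then (1 : ℚ) else 0) =
      (if 0 < orient (f a) (f b) (f c) then 1 else 0) *
        (if 0 < orient (f b) (f a) (f d) then 1 else 0) +
      (if 0 < orient (f b) (f a) (f c) then 1 else 0) *
        (if 0 < orient (f a) (f b) (f d) then 1 else 0) := by
    intro c d
    rw [orient_swap (f a) (f b) (f c), orient_swap (f a) (f b) (f d)]
    rcases lt_trichotomy (orient (f a) (f b) (f c)) 0 with h1 | h1 | h1 <;>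
    rcases lt_trichotomy (orient (f a) (f b) (f d)) 0 with h2 | h2 | h2 <;>
    simp [mul_neg_iff, h1, h2, h1.not_gt, h2.not_gt]
  simp only [h, Finset.sum_add_distrib, ← Finset.mul_sum, ← Finset.sum_mul]
  simp only [leftCount]
  ring

/-- The number of crossings in terms of separated pairs. -/
theorem RectilinearDrawing.crossings_eq {n : ℕ} (D : RectilinearDrawing n)
    (hD : GeneralPosition D.pt) :
    8 * (D.crossings : ℚ) = n * (n - 1) * (n - 2) * (n - 3) - 4 * separations D.pt := by
  classical
  have h1 := sum_four_pairings fun a b c d : Fin n =>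
      ((if orient (D.pt a) (D.pt b) (D.pt c) * orient (D.pt a) (D.pt b) (D.pt d) < 0
        then 1 else 0) +
      (if orient (D.pt c) (D.pt d) (D.pt a) * orient (D.pt c) (D.pt d) (D.pt b) < 0
        then 1 else 0) +
      (if Crosses (D.pt a) (D.pt b) (D.pt c) (D.pt d) then 1 else 0) : ℚ)
  simp only [hD.pairings_eq _ (fun _ _ _ _ => rfl), ← Finset.mul_sum] at h1
  rw [sum_four_distinct, Fintype.card_fin] at h1
  simp only [Finset.sum_add_distrib] at h1
  rw [sum_separated, sum_four_swap_pairs fun a b c d : Fin n =>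
    (if orient (D.pt a) (D.pt b) (D.pt c) * orient (D.pt a) (D.pt b) (D.pt d) < 0
      then (1 : ℚ) else 0), sum_separated] at h1
  have h2 := D.eight_mul_crossings hD
  have h3 : (8 * D.crossings : ℚ) = ∑ a, ∑ b, ∑ c, ∑ d,
      if Crosses (D.pt a) (D.pt b) (D.pt c) (D.pt d) then (1 : ℚ) else 0 := by
    rw [show (8 * D.crossings : ℚ) = ((8 * D.crossings : ℕ) : ℚ) by push_cast; ring, h2,
      Finset.card_filter]
    push_cast
    simp only [Fintype.sum_prod_type]
  linarith

/-! ### Perturbing away concurrent edges -/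

/-- The determinant of the coefficients of the lines `p q`, `r s` and `t u`, over any commutative
ring so that it can be formed for generic points. It vanishes if the three lines have a common
point. -/
def concurrencyDet {R : Type*} [CommRing R] (p q r s t u : R × R) : R :=
  (p.2 - q.2) * ((s.1 - r.1) * ((u.2 - t.2) * t.1 - (u.1 - t.1) * t.2) -
      (u.1 - t.1) * ((s.2 - r.2) * r.1 - (s.1 - r.1) * r.2)) -
    (q.1 - p.1) * ((r.2 - s.2) * ((u.2 - t.2) * t.1 - (u.1 - t.1) * t.2) -
      (t.2 - u.2) * ((s.2 - r.2) * r.1 - (s.1 - r.1) * r.2)) +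
    ((q.2 - p.2) * p.1 - (q.1 - p.1) * p.2) *
      ((r.2 - s.2) * (u.1 - t.1) - (s.1 - r.1) * (t.2 - u.2))

theorem concurrencyDet_eq_zero {p q r s t u x : ℝ × ℝ} (h1 : orient p q x = 0)
    (h2 : orient r s x = 0) (h3 : orient t u x = 0) : concurrencyDet p q r s t u = 0 := by
  unfold orient at h1 h2 h3
  unfold concurrencyDet
  linear_combination ((r.2 - s.2) * (u.1 - t.1) - (s.1 - r.1) * (t.2 - u.2)) * h1 -
    ((p.2 - q.2) * (u.1 - t.1) - (q.1 - p.1) * (t.2 - u.2)) * h2 +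
    ((p.2 - q.2) * (s.1 - r.1) - (q.1 - p.1) * (r.2 - s.2)) * h3

open MvPolynomial in
/-- Arbitrarily close to every family of points there is one such that no three lines through six
different points of the family are concurrent: concurrency of three such lines is a nontrivial
polynomial equation in the coordinates. -/
theorem exists_not_concurrent {ι : Type*} [Fintype ι] (f₀ : ι → ℝ × ℝ)
    {U : Set (ι → ℝ × ℝ)} (hU : U ∈ nhds f₀) :
    ∃ f ∈ U, ∀ g : Fin 6 ↪ ι, ∀ x, orient (f (g 0)) (f (g 1)) x = 0 →
      orient (f (g 2)) (f (g 3)) x = 0 → orient (f (g 4)) (f (g 5)) x ≠ 0 := by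
  classical
  let pt : (ι × Bool → ℝ) → ι → ℝ × ℝ := fun y u => (y (u, false), y (u, true))
  let V : ι → MvPolynomial (ι × Bool) ℝ × MvPolynomial (ι × Bool) ℝ :=
    fun u => (X (u, false), X (u, true))
  let P : (Fin 6 ↪ ι) → MvPolynomial (ι × Bool) ℝ := fun g =>
    concurrencyDet (V (g 0)) (V (g 1)) (V (g 2)) (V (g 3)) (V (g 4)) (V (g 5))
  have hP : ∀ g y, eval y (P g) = concurrencyDet (pt y (g 0)) (pt y (g 1)) (pt y (g 2))
      (pt y (g 3)) (pt y (g 4)) (pt y (g 5)) := by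
    intro g y
    simp [P, V, pt, concurrencyDet]
  have hP0 : ∏ g, P g ≠ 0 := by
    rw [Finset.prod_ne_zero_iff]
    intro g _ h0
    -- the lines `y = 0`, `x = 0` and `x + y = 1`
    let c : Fin 6 → Bool → ℝ := fun i b =>
      if b then ![0, 0, 0, 1, 0, 1] i else ![0, 1, 0, 0, 1, 0] i
    let e : Fin 6 × Bool → ι × Bool := fun z => (g z.1, z.2)
    have he : Function.Injective e := by
      rintro ⟨i, b⟩ ⟨i', b'⟩ h
      simpa [e] using h
    let y : ι × Bool → ℝ := Function.extend e (fun z => c z.1 z.2) 0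
    have hy : ∀ i b, y (g i, b) = c i b := fun i b => he.extend_apply _ _ (i, b)
    have := hP g y
    rw [h0, map_zero] at this
    simp only [pt, hy, c, concurrencyDet] at this
    simp at this
  let y₀ : ι × Bool → ℝ := fun z => if z.2 then (f₀ z.1).2 else (f₀ z.1).1
  have hcont : Continuous pt := by fun_prop
  have hy₀ : pt y₀ = f₀ := by ext u <;> simp [pt, y₀]
  have hU' : pt ⁻¹' U ∈ nhds y₀ := hcont.continuousAt (by rwa [hy₀])
  obtain ⟨r, hr, hball⟩ := Metric.mem_nhds_iff.1 hU'
  rw [ball_pi _ hr] at hball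
  obtain ⟨y, hy, hne⟩ : ∃ y ∈ Set.pi Set.univ fun z => Metric.ball (y₀ z) r,
      eval y (∏ g, P g) ≠ 0 := by
    by_contra! hcon
    refine hP0 (funext_set _ (fun z => ?_) fun y hy => (hcon y hy).trans (map_zero _).symm)
    rw [Real.ball_eq_Ioo]
    exact Set.Ioo_infinite (by linarith)
  refine ⟨pt y, hball hy, fun g x h1 h2 h3 => ?_⟩
  rw [map_prod, Finset.prod_ne_zero_iff] at hne
  exact hne g (Finset.mem_univ g) ((hP g y).trans (concurrencyDet_eq_zero h1 h2 h3))

theorem mem_edge_of_mem_edgeSegment {V : Type*} {f : V → ℝ × ℝ} (hf : GeneralPosition f)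
    {e : Sym2 V} (he : ¬e.IsDiag) {v : V} (h : f v ∈ edgeSegment f e) : v ∈ e := by
  induction e using Sym2.ind with | _ p q => ?_
  have h0 := orient_eq_zero_of_mem_segment h
  by_contra hv
  simp only [Sym2.mem_iff, not_or] at hv
  exact hf p q v (by simpa using he) (Ne.symm hv.2) (Ne.symm hv.1) h0

/-- Two distinct edges with a common vertex have no other point in common. -/
theorem eq_of_mem_edgeSegment {V : Type*} {f : V → ℝ × ℝ} (hf : GeneralPosition f)
    {e e' : Sym2 V} (he : ¬e.IsDiag) (he' : ¬e'.IsDiag) (hne : e ≠ e') {v : V} (hv : v ∈ e)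
    (hv' : v ∈ e') {x : ℝ × ℝ} (hx : x ∈ edgeSegment f e) (hx' : x ∈ edgeSegment f e') :
    f v = x := by
  obtain ⟨p, rfl⟩ := Sym2.mem_iff_exists.1 hv
  obtain ⟨q, rfl⟩ := Sym2.mem_iff_exists.1 hv'
  have h1 : orient (f v) (f p) x = 0 := orient_eq_zero_of_mem_segment hx
  have h2 : orient (f v) (f q) x = 0 := orient_eq_zero_of_mem_segment hx'
  have h0 : orient (f v) (f p) (f q) ≠ 0 :=
    hf v p q (by simpa using he) (fun h => hne (by rw [h])) (by simpa using he')
  -- the vectors from `f v` to `f p` and `f q` are a basis, so `x - f v` vanishes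
  ext
  · refine mul_left_cancel₀ h0 ?_
    unfold orient at *
    linear_combination ((f p).1 - (f v).1) * h2 - ((f q).1 - (f v).1) * h1
  · refine mul_left_cancel₀ h0 ?_
    unfold orient at *
    linear_combination ((f p).2 - (f v).2) * h2 - ((f q).2 - (f v).2) * h1

theorem exists_vertex_of_mem_edgeSegment {V : Type*} {f : V → ℝ × ℝ} (hf : GeneralPosition f)
    {e₁ e₂ e₃ : Sym2 V} (h₁ : ¬e₁.IsDiag) (h₂ : ¬e₂.IsDiag) (h₃ : ¬e₃.IsDiag) (hne : e₁ ≠ e₂)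
    {v : V} (hv₁ : v ∈ e₁) (hv₂ : v ∈ e₂) {x : ℝ × ℝ} (hx₁ : x ∈ edgeSegment f e₁)
    (hx₂ : x ∈ edgeSegment f e₂) (hx₃ : x ∈ edgeSegment f e₃) :
    f v = x ∧ v ∈ e₃ := by
  have h := eq_of_mem_edgeSegment hf h₁ h₂ hne hv₁ hv₂ hx₁ hx₂
  exact ⟨h, mem_edge_of_mem_edgeSegment hf h₃ (h ▸ hx₃)⟩

/-- Points in general position such that no three lines through six different points are
concurrent are the vertices of a rectilinear drawing. -/
def GeneralPosition.drawing {n : ℕ} {f : Fin n → ℝ × ℝ} (hf : GeneralPosition f)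
    (hinj : Function.Injective f)
    (hc : ∀ g : Fin 6 ↪ Fin n, ∀ x, orient (f (g 0)) (f (g 1)) x = 0 →
      orient (f (g 2)) (f (g 3)) x = 0 → orient (f (g 4)) (f (g 5)) x ≠ 0) :
    RectilinearDrawing n where
  pt := f
  injective := hinj
  not_collinear u v w huv hvw huw h := hf u v w huv hvw huw (orient_eq_zero_of_collinear h)
  not_concurrent := by
    intro e₁ h₁ e₂ h₂ e₃ h₃ h12 h23 h13 x hx₁ hx₂ hx₃
    replace h₁ := SimpleGraph.not_isDiag_of_mem_edgeSet _ h₁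
    replace h₂ := SimpleGraph.not_isDiag_of_mem_edgeSet _ h₂
    replace h₃ := SimpleGraph.not_isDiag_of_mem_edgeSet _ h₃
    by_cases d12 : ∃ v, v ∈ e₁ ∧ v ∈ e₂
    · obtain ⟨v, hv, hv'⟩ := d12
      obtain ⟨h, h'⟩ := exists_vertex_of_mem_edgeSegment hf h₁ h₂ h₃ h12 hv hv' hx₁ hx₂ hx₃
      exact ⟨v, h, hv, hv', h'⟩
    by_cases d23 : ∃ v, v ∈ e₂ ∧ v ∈ e₃
    · obtain ⟨v, hv, hv'⟩ := d23
      obtain ⟨h, h'⟩ := exists_vertex_of_mem_edgeSegment hf h₂ h₃ h₁ h23 hv hv' hx₂ hx₃ hx₁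
      exact ⟨v, h, h', hv, hv'⟩
    by_cases d13 : ∃ v, v ∈ e₁ ∧ v ∈ e₃
    · obtain ⟨v, hv, hv'⟩ := d13
      obtain ⟨h, h'⟩ := exists_vertex_of_mem_edgeSegment hf h₁ h₃ h₂ h13 hv hv' hx₁ hx₃ hx₂
      exact ⟨v, h, hv, h', hv'⟩
    exfalso
    induction e₁ using Sym2.ind with | _ a b => ?_
    induction e₂ using Sym2.ind with | _ c d => ?_
    induction e₃ using Sym2.ind with | _ p q => ?_
    simp only [Sym2.mk_isDiag_iff, Sym2.mem_iff, not_exists, not_and, not_or] at *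
    have ha12 := d12 a (Or.inl rfl)
    have hb12 := d12 b (Or.inr rfl)
    have ha13 := d13 a (Or.inl rfl)
    have hb13 := d13 b (Or.inr rfl)
    have hc23 := d23 c (Or.inl rfl)
    have hd23 := d23 d (Or.inr rfl)
    have hg : Function.Injective ![a, b, c, d, p, q] := by
      rw [← List.nodup_ofFn]
      simp [List.ofFn_succ, *]
    exact hc ⟨_, hg⟩ x (orient_eq_zero_of_mem_segment hx₁) (orient_eq_zero_of_mem_segment hx₂)
      (orient_eq_zero_of_mem_segment hx₃)

/-! ### Singer families -/

/-- Index set of a Singer configuration of order `3 ^ j`: words of length `j`, the first letter of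
which tells the cluster (`0` left, `1` top, `2` right). -/
def Word : ℕ → Type
  | 0 => Unit
  | j + 1 => Fin 3 × Word j

noncomputable instance Word.instFintype : ∀ j, Fintype (Word j)
  | 0 => inferInstanceAs (Fintype Unit)
  | j + 1 => letI := Word.instFintype j; inferInstanceAs (Fintype (Fin 3 × Word j))

instance Word.instNonempty : ∀ j, Nonempty (Word j)
  | 0 => inferInstanceAs (Nonempty Unit)
  | j + 1 => letI := Word.instNonempty j; inferInstanceAs (Nonempty (Fin 3 × Word j))

theorem Word.card (j : ℕ) : Fintype.card (Word j) = 3 ^ j := by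
  induction j with
  | zero => rfl
  | succ j ih =>
    rw [show Fintype.card (Word (j + 1)) = Fintype.card (Fin 3 × Word j) from rfl,
      Fintype.card_prod, ih, Fintype.card_fin, pow_succ, mul_comm]

/-- The points of `g` are strictly above all lines through two points of `f`. -/
def FamilyAbove {α β : Type*} (f : α → ℝ × ℝ) (g : β → ℝ × ℝ) : Prop :=
  ∀ u v, (f u).1 < (f v).1 → ∀ w, 0 < orient (f u) (f v) (g w)

/-- The points of `g` are strictly below all lines through two points of `f`. -/
def FamilyBelow {α β : Type*} (f : α → ℝ × ℝ) (g : β → ℝ × ℝ) : Prop :=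
  ∀ u v, (f u).1 < (f v).1 → ∀ w, orient (f u) (f v) (g w) < 0

theorem FamilyAbove.docksAbove {α β : Type*} {f : α → ℝ × ℝ} {g : β → ℝ × ℝ}
    (h : FamilyAbove f g) : DocksAbove (Set.range f) (Set.range g) := by
  rintro _ ⟨u, rfl⟩ _ ⟨v, rfl⟩ huv _ ⟨w, rfl⟩
  exact h u v huv w

theorem FamilyBelow.docksBelow {α β : Type*} {f : α → ℝ × ℝ} {g : β → ℝ × ℝ}
    (h : FamilyBelow f g) : DocksBelow (Set.range f) (Set.range g) := by
  rintro _ ⟨u, rfl⟩ _ ⟨v, rfl⟩ huv _ ⟨w, rfl⟩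
  exact h u v huv w

/-- A parametrized Singer configuration of order `3 ^ j`. Of the two ways in which the left and
the right cluster can dock at the top cluster, the left cluster docks on its upper side. -/
def SingerFamily : ∀ j, (Word j → ℝ × ℝ) → Prop
  | 0, _ => True
  | j + 1, f =>
    let g : Fin 3 → Word j → ℝ × ℝ := fun i w => f (i, w)
    (∀ i, SingerFamily j (g i)) ∧
      (∀ u v, (g 0 u).1 < (g 1 v).1) ∧ (∀ u v, (g 1 u).1 < (g 2 v).1) ∧
      (∀ u v w, 0 < orient (g 0 u) (g 2 v) (g 1 w)) ∧
      (FamilyAbove (g 0) (g 1) ∧ FamilyBelow (g 0) (g 2)) ∧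
      (FamilyAbove (g 2) (g 1) ∧ FamilyBelow (g 2) (g 0)) ∧
      (FamilyAbove (g 1) (g 0) ∧ FamilyBelow (g 1) (g 2))

theorem SingerFamily.fst_injective {j : ℕ} {f : Word j → ℝ × ℝ} (hf : SingerFamily j f) :
    Function.Injective fun w => (f w).1 := by
  induction j with
  | zero => exact fun _ _ _ => rfl
  | succ j ih =>
    obtain ⟨hs, h01, h12, -⟩ := hf
    have h02 : ∀ u v, (f (0, u)).1 < (f (2, v)).1 := fun u v =>
      (h01 u (Classical.arbitrary _)).trans (h12 _ v)
    rintro ⟨i, u⟩ ⟨i', v⟩ (h : (f (i, u)).1 = (f (i', v)).1)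
    fin_cases i <;> fin_cases i'
    · exact congrArg _ (ih (hs 0) h)
    · exact absurd h (h01 u v).ne
    · exact absurd h (h02 u v).ne
    · exact absurd h (h01 v u).ne'
    · exact congrArg _ (ih (hs 1) h)
    · exact absurd h (h12 u v).ne
    · exact absurd h (h02 v u).ne'
    · exact absurd h (h12 v u).ne'
    · exact congrArg _ (ih (hs 2) h)

theorem range_word_succ {j : ℕ} (f : Fin 3 × Word j → ℝ × ℝ) :
    Set.range f = ⋃ i, Set.range fun w => f (i, w) := by
  ext x
  simp [Prod.exists]

theorem SingerFamily.isSinger {j : ℕ} {f : Word j → ℝ × ℝ} (hf : SingerFamily j f) :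
    IsSinger j (Set.range f) := by
  induction j with
  | zero =>
    exact ⟨f (), Set.range_unique (ι := Unit)⟩
  | succ j ih =>
    obtain ⟨hs, h01, h12, h012, h0, h2, h1⟩ := hf
    refine ⟨_, _, _, ?_, ih (hs 0), ih (hs 1), ih (hs 2), ?_, ?_, ?_,
      ⟨h0.1.docksAbove, h0.2.docksBelow⟩, ⟨h2.1.docksAbove, h2.2.docksBelow⟩,
      Or.inl ⟨h1.1.docksAbove, h1.2.docksBelow⟩⟩
    · refine (range_word_succ f).trans ?_
      ext x
      simp [Fin.exists_fin_succ, or_assoc]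
    · rintro _ ⟨u, rfl⟩ _ ⟨v, rfl⟩
      exact h01 u v
    · rintro _ ⟨u, rfl⟩ _ ⟨v, rfl⟩
      exact h12 u v
    · rintro _ ⟨u, rfl⟩ _ ⟨v, rfl⟩ _ ⟨w, rfl⟩
      exact h012 u w v

/-! ### Stability under small perturbations -/

section Stability

open Filter Topology

variable {Y : Type*} {l : Filter Y}

theorem tendsto_orient {p q r : Y → ℝ × ℝ} {a b c : ℝ × ℝ} (hp : Tendsto p l (𝓝 a))
    (hq : Tendsto q l (𝓝 b)) (hr : Tendsto r l (𝓝 c)) :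
    Tendsto (fun y => orient (p y) (q y) (r y)) l (𝓝 (orient a b c)) := by
  have hc : Continuous fun z : (ℝ × ℝ) × (ℝ × ℝ) × (ℝ × ℝ) => orient z.1 z.2.1 z.2.2 := by
    unfold orient
    fun_prop
  exact (hc.tendsto (a, b, c)).comp (hp.prodMk_nhds (hq.prodMk_nhds hr))

theorem eventually_fst_lt {p q : Y → ℝ × ℝ} {a b : ℝ × ℝ} (hp : Tendsto p l (𝓝 a))
    (hq : Tendsto q l (𝓝 b)) (h : a.1 < b.1) : ∀ᶠ y in l, (p y).1 < (q y).1 :=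
  ((continuous_fst.tendsto a).comp hp).eventually_lt ((continuous_fst.tendsto b).comp hq) h

theorem eventually_of_fst_lt {α : Type*} [Finite α] {p : Y → α → ℝ × ℝ} {a : α → ℝ × ℝ}
    (hp : ∀ u, Tendsto (fun y => p y u) l (𝓝 (a u))) (hinj : Function.Injective fun u => (a u).1)
    {P : α → α → Y → Prop} (h : ∀ u v, (a u).1 < (a v).1 → ∀ᶠ y in l, P u v y) :
    ∀ᶠ y in l, ∀ u v, (p y u).1 < (p y v).1 → P u v y := by
  refine eventually_all.2 fun u => eventually_all.2 fun v => ?_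
  rcases lt_trichotomy (a u).1 (a v).1 with huv | huv | huv
  · filter_upwards [h u v huv] with y hy _ using hy
  · obtain rfl := hinj huv
    exact Eventually.of_forall fun y hy => absurd hy (lt_irrefl _)
  · filter_upwards [eventually_fst_lt (hp v) (hp u) huv] with y hy hy' using
      absurd hy' hy.not_gt

theorem FamilyAbove.eventually {α β : Type*} [Finite α] [Finite β] {p : Y → α → ℝ × ℝ}
    {q : Y → β → ℝ × ℝ} {a : α → ℝ × ℝ} {b : β → ℝ × ℝ}
    (hp : ∀ u, Tendsto (fun y => p y u) l (𝓝 (a u)))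
    (hq : ∀ u, Tendsto (fun y => q y u) l (𝓝 (b u)))
    (hinj : Function.Injective fun u => (a u).1) (h : FamilyAbove a b) :
    ∀ᶠ y in l, FamilyAbove (p y) (q y) :=
  eventually_of_fst_lt hp hinj fun u v huv => eventually_all.2 fun w =>
    (tendsto_orient (hp u) (hp v) (hq w)).eventually_const_lt (h u v huv w)

theorem FamilyBelow.eventually {α β : Type*} [Finite α] [Finite β] {p : Y → α → ℝ × ℝ}
    {q : Y → β → ℝ × ℝ} {a : α → ℝ × ℝ} {b : β → ℝ × ℝ}
    (hp : ∀ u, Tendsto (fun y => p y u) l (𝓝 (a u)))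
    (hq : ∀ u, Tendsto (fun y => q y u) l (𝓝 (b u)))
    (hinj : Function.Injective fun u => (a u).1) (h : FamilyBelow a b) :
    ∀ᶠ y in l, FamilyBelow (p y) (q y) :=
  eventually_of_fst_lt hp hinj fun u v huv => eventually_all.2 fun w =>
    (tendsto_orient (hp u) (hp v) (hq w)).eventually_lt_const (h u v huv w)

theorem SingerFamily.eventually {j : ℕ} {p : Y → Word j → ℝ × ℝ} {a : Word j → ℝ × ℝ}
    (hp : ∀ u, Tendsto (fun y => p y u) l (𝓝 (a u))) (h : SingerFamily j a) :
    ∀ᶠ y in l, SingerFamily j (p y) := by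
  induction j with
  | zero => exact Eventually.of_forall fun _ => trivial
  | succ j ih =>
    obtain ⟨hs, h01, h12, h012, h0, h2, h1⟩ := h
    have hp' : ∀ i u, Tendsto (fun y => p y (i, u)) l (𝓝 (a (i, u))) := fun i u => hp (i, u)
    have hi : ∀ i, Function.Injective fun u => (a (i, u)).1 := fun i => (hs i).fst_injective
    refine (eventually_all.2 fun i => ih (hp' i) (hs i)).and
      (Eventually.and ?_ (Eventually.and ?_ (Eventually.and ?_ (Eventually.and
        (Eventually.and ?_ ?_) (Eventually.and (Eventually.and ?_ ?_) (Eventually.and ?_ ?_))))))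
    · exact eventually_all.2 fun u => eventually_all.2 fun v =>
        eventually_fst_lt (hp' 0 u) (hp' 1 v) (h01 u v)
    · exact eventually_all.2 fun u => eventually_all.2 fun v =>
        eventually_fst_lt (hp' 1 u) (hp' 2 v) (h12 u v)
    · exact eventually_all.2 fun u => eventually_all.2 fun v => eventually_all.2 fun w =>
        (tendsto_orient (hp' 0 u) (hp' 2 v) (hp' 1 w)).eventually_const_lt (h012 u v w)
    · exact h0.1.eventually (hp' 0) (hp' 1) (hi 0)
    · exact h0.2.eventually (hp' 0) (hp' 2) (hi 0)
    · exact h2.1.eventually (hp' 2) (hp' 1) (hi 2)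
    · exact h2.2.eventually (hp' 2) (hp' 0) (hi 2)
    · exact h1.1.eventually (hp' 1) (hp' 0) (hi 1)
    · exact h1.2.eventually (hp' 1) (hp' 2) (hi 1)

end Stability

/-! ### Existence of Singer families -/

section Existence

open Filter Topology

/-- Singer families are invariant under affine maps that preserve the orientation, the direction of
the vertical lines and the order from left to right. -/
theorem SingerFamily.shear {j : ℕ} {f : Word j → ℝ × ℝ} (hf : SingerFamily j f) {a d : ℝ}
    (ha : 0 < a) (hd : 0 < d) (x y b : ℝ) :
    SingerFamily j fun w => (x + a * (f w).1, y + b * (f w).1 + d * (f w).2) := by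
  have ho : ∀ p q r : ℝ × ℝ, orient (x + a * p.1, y + b * p.1 + d * p.2)
      (x + a * q.1, y + b * q.1 + d * q.2) (x + a * r.1, y + b * r.1 + d * r.2) =
      a * d * orient p q r := by
    intro p q r
    unfold orient
    ring
  have had := mul_pos ha hd
  have above : ∀ {α β : Type} {p : α → ℝ × ℝ} {q : β → ℝ × ℝ}, FamilyAbove p q →
      FamilyAbove (fun w => (x + a * (p w).1, y + b * (p w).1 + d * (p w).2))
        (fun w => (x + a * (q w).1, y + b * (q w).1 + d * (q w).2)) := by
    intro α β p q h u v huv w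
    simp only [ho]
    exact mul_pos had (h u v (lt_of_mul_lt_mul_left (by simpa using huv) ha.le) w)
  have below : ∀ {α β : Type} {p : α → ℝ × ℝ} {q : β → ℝ × ℝ}, FamilyBelow p q →
      FamilyBelow (fun w => (x + a * (p w).1, y + b * (p w).1 + d * (p w).2))
        (fun w => (x + a * (q w).1, y + b * (q w).1 + d * (q w).2)) := by
    intro α β p q h u v huv w
    simp only [ho]
    exact mul_neg_of_pos_of_neg had (h u v (lt_of_mul_lt_mul_left (by simpa using huv) ha.le) w)
  induction j with
  | zero => trivial
  | succ j ih =>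
    obtain ⟨hs, h01, h12, h012, h0, h2, h1⟩ := hf
    refine ⟨fun i => ih (hs i), fun u v => ?_, fun u v => ?_, fun u v w => ?_,
      ⟨above h0.1, below h0.2⟩, ⟨above h2.1, below h2.2⟩, ⟨above h1.1, below h1.2⟩⟩
    · exact add_lt_add_right (mul_lt_mul_of_pos_left (h01 u v) ha) x
    · exact add_lt_add_right (mul_lt_mul_of_pos_left (h12 u v) ha) x
    · simp only [ho]
      exact mul_pos had (h012 u v w)

/-- A function that is a power of `ε` times a function with a positive limit is positive for small
positive `ε`. -/
theorem eventually_pos_of_eq_pow_mul {P h : ℝ → ℝ} (n : ℕ) (hh : ContinuousAt h 0) (h0 : 0 < h 0)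
    (hP : ∀ ε, P ε = ε ^ n * h ε) : ∀ᶠ ε in 𝓝[>] (0 : ℝ), 0 < P ε := by
  filter_upwards [(hh.tendsto.mono_left nhdsWithin_le_nhds).eventually_const_lt h0,
    self_mem_nhdsWithin] with ε h1 h2
  rw [hP]
  exact mul_pos (pow_pos h2 n) h1

/-- A flattened copy of the point `p` near `(x, y)`, close to the line through `(x, y)` of
slope `m`. -/
def flatten (x y m ε : ℝ) (p : ℝ × ℝ) : ℝ × ℝ :=
  (x + ε * p.1, y + ε * m * p.1 + ε ^ 2 * p.2)

@[simp] theorem flatten_zero (x y m : ℝ) (p : ℝ × ℝ) : flatten x y m 0 p = (x, y) := by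
  simp [flatten]

theorem continuous_flatten (x y m : ℝ) (p : ℝ × ℝ) : Continuous fun ε => flatten x y m ε p := by
  unfold flatten
  fun_prop

theorem eventually_above_flatten {α : Type*} [Finite α] (f g : α → ℝ × ℝ) {x y m x' y' m' : ℝ}
    (h : 0 < y' - y - m * (x' - x)) :
    ∀ᶠ ε in 𝓝[>] (0 : ℝ),
      FamilyAbove (fun w => flatten x y m ε (f w)) (fun w => flatten x' y' m' ε (g w)) := by
  have key : ∀ᶠ ε in 𝓝[>] (0 : ℝ), ∀ u v w, (f u).1 < (f v).1 →
      0 < orient (flatten x y m ε (f u)) (flatten x y m ε (f v)) (flatten x' y' m' ε (g w)) := by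
    refine eventually_all.2 fun u => eventually_all.2 fun v => eventually_all.2 fun w => ?_
    by_cases huv : (f u).1 < (f v).1
    · refine (eventually_pos_of_eq_pow_mul 1 (h := fun ε =>
        ((f v).1 - (f u).1) * ((flatten x' y' m' ε (g w)).2 - (flatten x y m ε (f u)).2) -
        (m * ((f v).1 - (f u).1) + ε * ((f v).2 - (f u).2)) *
          ((flatten x' y' m' ε (g w)).1 - (flatten x y m ε (f u)).1)) ?_ ?_ ?_).mono
        fun ε h _ => h
      · unfold flatten
        fun_prop
      · simp only [flatten_zero]
        nlinarith [mul_pos (sub_pos.2 huv) h]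
      · intro ε
        unfold orient flatten
        ring
    · exact Eventually.of_forall fun ε h => absurd h huv
  filter_upwards [key, self_mem_nhdsWithin] with ε h hε u v huv w
  refine h u v w (lt_of_mul_lt_mul_left ?_ (le_of_lt hε))
  simpa [flatten] using huv

theorem eventually_below_flatten {α : Type*} [Finite α] (f g : α → ℝ × ℝ) {x y m x' y' m' : ℝ}
    (h : y' - y - m * (x' - x) < 0) :
    ∀ᶠ ε in 𝓝[>] (0 : ℝ),
      FamilyBelow (fun w => flatten x y m ε (f w)) (fun w => flatten x' y' m' ε (g w)) := by
  -- reflection in the horizontal axis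
  have key := eventually_above_flatten (fun w => ((f w).1, -(f w).2))
    (fun w => ((g w).1, -(g w).2)) (x := x) (y := -y) (m := -m) (x' := x') (y' := -y')
    (m' := -m') (by linarith)
  filter_upwards [key] with ε h u v huv w
  have := h u v huv w
  simp only [orient, flatten] at this ⊢
  linarith

theorem exists_singerFamily (j : ℕ) : ∃ f : Word j → ℝ × ℝ, SingerFamily j f := by
  induction j with
  | zero => exact ⟨fun _ => 0, trivial⟩
  | succ j ih =>
    obtain ⟨f, hf⟩ := ih
    -- The clusters are placed at `(0, 0)`, `(2, 2)`, `(4, 0)`; in the direction of the line through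
    -- each of these points with slope `1/2`, `2`, `-1/2`, which separates the other two points.
    let g : ℝ → Fin 3 → Word j → ℝ × ℝ := fun ε i w =>
      flatten (![0, 2, 4] i) (![0, 2, 0] i) (![1/2, 2, -1/2] i) ε (f w)
    have htend : ∀ i w, Tendsto (fun ε => g ε i w) (𝓝[>] 0) (𝓝 (![0, 2, 4] i, ![0, 2, 0] i)) := by
      intro i w
      have := (continuous_flatten (![0, 2, 4] i) (![0, 2, 0] i) (![1/2, 2, -1/2] i) (f w)).tendsto 0
      rw [flatten_zero] at this
      exact this.mono_left nhdsWithin_le_nhds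
    have hev : ∀ᶠ ε in 𝓝[>] (0 : ℝ), SingerFamily (j + 1) fun z => g ε z.1 z.2 := by
      refine Eventually.and ?_
        (Eventually.and ?_ (Eventually.and ?_ (Eventually.and ?_ (Eventually.and
          (Eventually.and ?_ ?_) (Eventually.and (Eventually.and ?_ ?_) (Eventually.and ?_ ?_))))))
      · filter_upwards [self_mem_nhdsWithin] with ε hε i
        exact hf.shear hε (pow_pos hε 2) _ _ _
      · exact eventually_all.2 fun u => eventually_all.2 fun v =>
          eventually_fst_lt (htend 0 u) (htend 1 v) (by simp)
      · exact eventually_all.2 fun u => eventually_all.2 fun v =>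
          eventually_fst_lt (htend 1 u) (htend 2 v) (by simp; norm_num)
      · exact eventually_all.2 fun u => eventually_all.2 fun v => eventually_all.2 fun w =>
          (tendsto_orient (htend 0 u) (htend 2 v) (htend 1 w)).eventually_const_lt
            (by simp [orient])
      · exact eventually_above_flatten f f (x := 0) (y := 0) (m := 1/2) (x' := 2) (y' := 2)
          (m' := 2) (by norm_num)
      · exact eventually_below_flatten f f (x := 0) (y := 0) (m := 1/2) (x' := 4) (y' := 0)
          (m' := -1/2) (by norm_num)
      · exact eventually_above_flatten f f (x := 4) (y := 0) (m := -1/2) (x' := 2) (y' := 2)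
          (m' := 2) (by norm_num)
      · exact eventually_below_flatten f f (x := 4) (y := 0) (m := -1/2) (x' := 0) (y' := 0)
          (m' := 1/2) (by norm_num)
      · exact eventually_above_flatten f f (x := 2) (y := 2) (m := 2) (x' := 0) (y' := 0)
          (m' := 1/2) (by norm_num)
      · exact eventually_below_flatten f f (x := 2) (y := 2) (m := 2) (x' := 4) (y' := 0)
          (m' := -1/2) (by norm_num)
    obtain ⟨ε, hε⟩ := hev.exists
    exact ⟨_, hε⟩

end Existence

/-! ### Ranks -/

theorem above_of_below {W : Type*} {a : W → ℝ × ℝ} {x : W → ℝ} {b : ℝ × ℝ}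
    (h : ∀ u v, x u < x v → orient (a u) (a v) b < 0) (u v : W)
    (huv : -x u < -x v) : 0 < orient (a u) (a v) b := by
  have := h v u (neg_lt_neg_iff.1 huv)
  rw [orient_swap] at this
  linarith

section Rank

variable {W : Type*} [Fintype W]

/-- The number of elements with a smaller value of `x`. -/
noncomputable def rankBy (x : W → ℝ) (u : W) : ℚ := ∑ w, if x w < x u then 1 else 0

theorem sum_ite_gt {x : W → ℝ} (hx : Function.Injective x) (u : W) :
    (∑ w, if x u < x w then 1 else 0 : ℚ) = Fintype.card W - 1 - rankBy x u := by
  classical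
  have h : ∀ w, (if x u < x w then 1 else 0 : ℚ) =
      1 - (if w = u then 1 else 0) - (if x w < x u then 1 else 0) := by
    intro w
    rcases lt_trichotomy (x u) (x w) with h | h | h
    · have : w ≠ u := by rintro rfl; exact lt_irrefl _ h
      simp [h, h.not_gt, this]
    · obtain rfl := hx h
      simp
    · have : w ≠ u := by rintro rfl; exact lt_irrefl _ h
      simp [h, h.not_gt, this]
  simp only [h, Finset.sum_sub_distrib, rankBy]
  simp

/-- The ranks of the elements are `0, 1, …, k - 1`. -/
theorem sum_comp_rankBy {x : W → ℝ} (hx : Function.Injective x) (φ : ℚ → ℚ) :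
    ∑ u, φ (rankBy x u) = ∑ r ∈ Finset.range (Fintype.card W), φ r := by
  classical
  let ρ : W → ℕ := fun u => (Finset.univ.filter fun w => x w < x u).card
  have hlt : ∀ u v, x u < x v → ρ u < ρ v := by
    intro u v huv
    refine Finset.card_lt_card ⟨fun w hw => ?_, fun hsub => ?_⟩
    · simp only [Finset.mem_filter, Finset.mem_univ, true_and] at hw ⊢
      exact hw.trans huv
    · have := hsub (show u ∈ _ by simpa using huv)
      simp at this
  have hinj : Function.Injective ρ := by
    intro u v huv
    rcases lt_trichotomy (x u) (x v) with h | h | h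
    · exact absurd huv (hlt _ _ h).ne
    · exact hx h
    · exact absurd huv (hlt _ _ h).ne'
  have himg : Finset.univ.image ρ = Finset.range (Fintype.card W) := by
    refine Finset.eq_of_subset_of_card_le ?_ ?_
    · intro r hr
      obtain ⟨u, -, rfl⟩ := Finset.mem_image.1 hr
      rw [Finset.mem_range, ← Finset.card_univ]
      exact Finset.card_lt_card ⟨Finset.filter_subset _ _, fun hsub => by
        simpa using hsub (Finset.mem_univ u)⟩
    · rw [Finset.card_image_of_injective _ hinj, Finset.card_range, Finset.card_univ]
  rw [← himg, Finset.sum_image hinj.injOn]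
  refine Finset.sum_congr rfl fun u _ => ?_
  simp [ρ, rankBy]

theorem sum_rankBy {x : W → ℝ} (hx : Function.Injective x) :
    ∑ u, rankBy x u = Fintype.card W * (Fintype.card W - 1) / 2 := by
  rw [sum_comp_rankBy hx fun r => r]
  induction Fintype.card W with
  | zero => simp
  | succ k ih => rw [Finset.sum_range_succ, ih]; push_cast; ring

theorem sum_rankBy_sq {x : W → ℝ} (hx : Function.Injective x) :
    ∑ u, rankBy x u ^ 2 =
      Fintype.card W * (Fintype.card W - 1) * (2 * Fintype.card W - 1) / 6 := by
  rw [sum_comp_rankBy hx fun r => r ^ 2]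
  induction Fintype.card W with
  | zero => simp
  | succ k ih => rw [Finset.sum_range_succ, ih]; push_cast; ring

theorem sum_quadratic_rankBy {x : W → ℝ} (hx : Function.Injective x) (α β γ : ℚ) :
    ∑ u, (α + β * rankBy x u + γ * rankBy x u ^ 2) = Fintype.card W * α +
      β * (Fintype.card W * (Fintype.card W - 1) / 2) +
      γ * (Fintype.card W * (Fintype.card W - 1) * (2 * Fintype.card W - 1) / 6) := by
  rw [Finset.sum_add_distrib, Finset.sum_add_distrib, ← Finset.mul_sum, ← Finset.mul_sum,
    sum_rankBy hx, sum_rankBy_sq hx]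
  simp

theorem sum_sum_ite_lt {x : W → ℝ} (hx : Function.Injective x) :
    (∑ u, ∑ v, if x u < x v then 1 else 0 : ℚ) =
      Fintype.card W * (Fintype.card W - 1) / 2 := by
  rw [Finset.sum_comm, ← sum_rankBy hx]
  rfl

/-- A symmetric sum over pairs is twice the sum over increasing pairs. -/
theorem sum_sum_eq_two_mul {x : W → ℝ} (hx : Function.Injective x) {h : W → W → ℚ}
    (hsymm : ∀ u v, h u v = h v u) (h0 : ∀ u, h u u = 0) :
    ∑ u, ∑ v, h u v = 2 * ∑ u, ∑ v, if x u < x v then h u v else 0 := by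
  have hsplit : ∀ u v, h u v = (if x u < x v then h u v else 0) +
      (if x v < x u then h v u else 0) := by
    intro u v
    rcases lt_trichotomy (x u) (x v) with h1 | h1 | h1
    · simp [h1, h1.not_gt]
    · obtain rfl := hx h1
      simp [h0]
    · simp [h1, h1.not_gt, hsymm u v]
  rw [Finset.sum_congr rfl fun u _ => Finset.sum_congr rfl fun v _ => hsplit u v]
  simp only [Finset.sum_add_distrib]
  rw [Finset.sum_comm (f := fun u v => if x v < x u then h v u else 0)]
  ring

variable {a : W → ℝ × ℝ} {x : W → ℝ} {b : ℝ × ℝ}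

/-- If `b` is above all lines of a cluster, then the line from `a u` to `b` has the points before
`a u` to its left. -/
theorem sum_left_of_above (h : ∀ u v, x u < x v → 0 < orient (a u) (a v) b)
    (hx : Function.Injective x) (u : W) :
    (∑ w, if 0 < orient (a u) b (a w) then 1 else 0 : ℚ) = rankBy x u := by
  refine Finset.sum_congr rfl fun w _ => if_congr ?_ rfl rfl
  rw [show orient (a u) b (a w) = orient (a w) (a u) b from orient_rotate _ _ _]
  rcases lt_trichotomy (x w) (x u) with h1 | h1 | h1
  · exact iff_of_true (h w u h1) h1
  · obtain rfl := hx h1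
    simp
  · have := h u w h1
    rw [orient_swap] at this
    exact iff_of_false (by linarith) h1.not_gt

theorem sum_left_to_above (h : ∀ u v, x u < x v → 0 < orient (a u) (a v) b)
    (hx : Function.Injective x) (u : W) :
    (∑ w, if 0 < orient b (a u) (a w) then 1 else 0 : ℚ) =
      Fintype.card W - 1 - rankBy x u := by
  rw [← sum_ite_gt hx]
  refine Finset.sum_congr rfl fun w _ => if_congr ?_ rfl rfl
  rw [← orient_rotate b]
  rcases lt_trichotomy (x u) (x w) with h1 | h1 | h1
  · exact iff_of_true (h u w h1) h1
  · obtain rfl := hx h1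
    simp
  · have := h w u h1
    rw [orient_swap] at this
    exact iff_of_false (by linarith) h1.not_gt

theorem rankBy_neg (hx : Function.Injective x) (u : W) :
    rankBy (fun u => -x u) u = Fintype.card W - 1 - rankBy x u := by
  rw [← sum_ite_gt hx, rankBy]
  simp only [neg_lt_neg_iff]

theorem sum_left_of_below (h : ∀ u v, x u < x v → orient (a u) (a v) b < 0)
    (hx : Function.Injective x) (u : W) :
    (∑ w, if 0 < orient (a u) b (a w) then 1 else 0 : ℚ) =
      Fintype.card W - 1 - rankBy x u := by
  rw [sum_left_of_above (above_of_below h) (neg_injective.comp hx), rankBy_neg hx]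

theorem sum_left_to_below (h : ∀ u v, x u < x v → orient (a u) (a v) b < 0)
    (hx : Function.Injective x) (u : W) :
    (∑ w, if 0 < orient b (a u) (a w) then 1 else 0 : ℚ) = rankBy x u := by
  rw [sum_left_to_above (above_of_below h) (neg_injective.comp hx), rankBy_neg hx]
  ring

end Rank

/-! ### Three clusters -/

/-- Three clusters in counterclockwise order such that the lines of each cluster `g i`, directed by
increasing `x i`, have the next cluster to their left, and split the third one into the points with
index in `s` to their right and the others to their left. -/
structure ThreeClusters {W : Type*} (g : Fin 3 → W → ℝ × ℝ) (x : Fin 3 → W → ℝ) (s : Set W) :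
    Prop where
  injective : ∀ i, Function.Injective (x i)
  ccw : ∀ i u v w, 0 < orient (g i u) (g (i + 1) v) (g (i + 2) w)
  next : ∀ i u v, x i u < x i v → ∀ w, 0 < orient (g i u) (g i v) (g (i + 1) w)
  right : ∀ i u v, x i u < x i v → ∀ w ∈ s, orient (g i u) (g i v) (g (i + 2) w) < 0
  left : ∀ i u v, x i u < x i v → ∀ w ∉ s, 0 < orient (g i u) (g i v) (g (i + 2) w)

/-- The whole family of three clusters. -/
def unionFamily {W : Type*} (g : Fin 3 → W → ℝ × ℝ) (z : Fin 3 × W) : ℝ × ℝ := g z.1 z.2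

theorem sum_fin_three_rotate (h : Fin 3 → ℚ) (i : Fin 3) :
    ∑ i', h i' = h i + h (i + 1) + h (i + 2) := by
  rw [Fin.sum_univ_three]
  fin_cases i
  · rfl
  · exact (add_rotate (h 0) (h 1) (h 2))
  · exact (add_rotate (h 2) (h 0) (h 1)).symm

theorem leftCount_unionFamily {W : Type*} [Fintype W] (g : Fin 3 → W → ℝ × ℝ)
    (p q : Fin 3 × W) (i : Fin 3) :
    leftCount (unionFamily g) p q =
      (∑ w, if 0 < orient (g p.1 p.2) (g q.1 q.2) (g i w) then 1 else 0) +
      (∑ w, if 0 < orient (g p.1 p.2) (g q.1 q.2) (g (i + 1) w) then 1 else 0) +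
      (∑ w, if 0 < orient (g p.1 p.2) (g q.1 q.2) (g (i + 2) w) then 1 else 0) := by
  rw [leftCount, Fintype.sum_prod_type]
  exact sum_fin_three_rotate
    (fun i => ∑ w, if 0 < orient (g p.1 p.2) (g q.1 q.2) (g i w) then 1 else 0) i

/-- The sum over increasing pairs of the number of points on the upper side of their line. -/
noncomputable def upperCount {W : Type*} [Fintype W] (f : W → ℝ × ℝ) (x : W → ℝ) : ℚ :=
  ∑ u, ∑ v, if x u < x v then leftCount f u v else 0

namespace ThreeClusters

variable {W : Type*} {g : Fin 3 → W → ℝ × ℝ} {x : Fin 3 → W → ℝ} {s : Set W}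

theorem orient_pair_ne_zero (h : ThreeClusters g x s) {i i' : Fin 3} (hi : i ≠ i') {u v : W}
    (huv : u ≠ v) (w : W) : orient (g i u) (g i v) (g i' w) ≠ 0 := by
  have main : ∀ u v, x i u < x i v → orient (g i u) (g i v) (g i' w) ≠ 0 := by
    intro u v hlt
    have hcase : i' = i + 1 ∨ i' = i + 2 := by omega
    rcases hcase with rfl | rfl
    · exact (h.next i u v hlt w).ne'
    · by_cases hw : w ∈ s
      · exact (h.right i u v hlt w hw).ne
      · exact (h.left i u v hlt w hw).ne'
  rcases lt_or_gt_of_ne ((h.injective i).ne huv) with hlt | hlt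
  · exact main u v hlt
  · have := main v u hlt
    rwa [orient_swap, neg_ne_zero] at this

theorem generalPosition (h : ThreeClusters g x s) (hg : ∀ i, GeneralPosition (g i)) :
    GeneralPosition (unionFamily g) := by
  rintro ⟨i, u⟩ ⟨i', v⟩ ⟨i'', w⟩ h1 h2 h3
  show orient (g i u) (g i' v) (g i'' w) ≠ 0
  by_cases e1 : i = i'
  · subst e1
    have huv : u ≠ v := fun e => h1 (by rw [e])
    by_cases e2 : i = i''
    · subst e2
      exact hg i u v w huv (fun e => h2 (by rw [e])) (fun e => h3 (by rw [e]))
    · exact h.orient_pair_ne_zero e2 huv w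
  by_cases e2 : i' = i''
  · subst e2
    rw [← orient_rotate]
    exact h.orient_pair_ne_zero (Ne.symm e1) (fun e => h2 (by rw [e])) u
  by_cases e3 : i = i''
  · subst e3
    rw [← orient_rotate, ← orient_rotate]
    exact h.orient_pair_ne_zero e1 (fun e => h3 (by rw [e])) v
  have hcase : (i' = i + 1 ∧ i'' = i + 2) ∨ (i' = i + 2 ∧ i'' = i + 1) := by omega
  rcases hcase with ⟨rfl, rfl⟩ | ⟨rfl, rfl⟩
  · exact (h.ccw i u v w).ne'
  · have := (h.ccw i u w v).ne'
    rw [← orient_rotate, ← orient_rotate, orient_swap, neg_ne_zero] at this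
    exact this

variable [Fintype W]

open Classical in
theorem leftCount_same (h : ThreeClusters g x s) (i : Fin 3) {u v : W} (huv : x i u < x i v) :
    leftCount (unionFamily g) (i, u) (i, v) =
        leftCount (g i) u v + (2 * Fintype.card W - ∑ w, if w ∈ s then 1 else 0) ∧
      leftCount (unionFamily g) (i, v) (i, u) =
        leftCount (g i) v u + ∑ w, if w ∈ s then 1 else 0 := by
  have e1 : ∀ w, 0 < orient (g i u) (g i v) (g (i + 1) w) := h.next i u v huv
  have e2 : ∀ w, ¬0 < orient (g i v) (g i u) (g (i + 1) w) := fun w => by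
    rw [orient_swap]; linarith [e1 w]
  have e3 : ∀ w, 0 < orient (g i u) (g i v) (g (i + 2) w) ↔ w ∉ s := fun w => by
    by_cases hw : w ∈ s
    · exact iff_of_false (h.right i u v huv w hw).not_gt (by simpa using hw)
    · exact iff_of_true (h.left i u v huv w hw) hw
  have e4 : ∀ w, 0 < orient (g i v) (g i u) (g (i + 2) w) ↔ w ∈ s := fun w => by
    rw [orient_swap]
    by_cases hw : w ∈ s
    · exact iff_of_true (by linarith [h.right i u v huv w hw]) hw
    · exact iff_of_false (by linarith [h.left i u v huv w hw]) hw
  have e5 : (∑ w, if w ∉ s then 1 else 0 : ℚ) =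
      Fintype.card W - ∑ w, if w ∈ s then 1 else 0 := by
    rw [eq_sub_iff_add_eq, ← Finset.sum_add_distrib]
    have : ∀ w, ((if w ∉ s then 1 else 0) + (if w ∈ s then 1 else 0) : ℚ) = 1 := by
      intro w; by_cases hw : w ∈ s <;> simp [hw]
    simp only [this]
    simp
  rw [leftCount_unionFamily g (i, u) (i, v) i, leftCount_unionFamily g (i, v) (i, u) i]
  simp only [e1, e2, e3, e4, if_true, if_false, e5, leftCount, Finset.sum_const_zero,
    Finset.sum_const, Finset.card_univ, nsmul_eq_mul]
  constructor <;> ring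

open Classical in
theorem leftCount_next (h : ThreeClusters g x s) (i : Fin 3) (u v : W) :
    leftCount (unionFamily g) (i, u) (i + 1, v) = Fintype.card W + rankBy (x i) u +
      if u ∈ s then rankBy (x (i + 1)) v else Fintype.card W - 1 - rankBy (x (i + 1)) v := by
  have e1 := sum_left_of_above (b := g (i + 1) v) (fun u' v' huv => h.next i u' v' huv v)
    (h.injective i) u
  have e2 : (∑ w, if 0 < orient (g i u) (g (i + 1) v) (g (i + 1) w) then 1 else 0 : ℚ) =
      if u ∈ s then rankBy (x (i + 1)) v else Fintype.card W - 1 - rankBy (x (i + 1)) v := by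
    have hi : i + 1 + 2 = i := by omega
    by_cases hu : u ∈ s
    · rw [if_pos hu]
      refine sum_left_to_below (fun u' v' huv => ?_) (h.injective (i + 1)) v
      have := h.right (i + 1) u' v' huv u hu
      rwa [hi] at this
    · rw [if_neg hu]
      refine sum_left_to_above (fun u' v' huv => ?_) (h.injective (i + 1)) v
      have := h.left (i + 1) u' v' huv u hu
      rwa [hi] at this
  rw [leftCount_unionFamily g (i, u) (i + 1, v) i]
  simp only [e1, e2, h.ccw i u v, if_true, Finset.sum_const, Finset.card_univ, nsmul_eq_mul]
  ring

/-- The contribution of the lines between two clusters. It does not depend on the way in which the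
clusters are split, since reversing the order of a cluster only permutes its ranks. -/
theorem sum_next (h : ThreeClusters g x s) (hg : ∀ i, GeneralPosition (g i)) (i : Fin 3) :
    ∑ u, ∑ v, leftCount (unionFamily g) (i, u) (i + 1, v) *
      leftCount (unionFamily g) (i + 1, v) (i, u) =
    (Fintype.card W : ℚ) ^ 2 * (Fintype.card W - 1) * (11 * Fintype.card W - 7) / 6 := by
  classical
  set k : ℚ := (Fintype.card W : ℚ) with hk
  have hcard : (Fintype.card (Fin 3 × W) : ℚ) = 3 * k := by
    rw [Fintype.card_prod, Fintype.card_fin, hk]; push_cast; ring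
  have hL : ∀ u v, leftCount (unionFamily g) (i + 1, v) (i, u) =
      3 * k - 2 - leftCount (unionFamily g) (i, u) (i + 1, v) := by
    intro u v
    have := (h.generalPosition hg).leftCount_add (p := (i, u)) (q := (i + 1, v))
      (fun e => by have := congrArg Prod.fst e; simp at this)
    rw [hcard] at this
    linarith
  have inner : ∀ u, ∑ v, leftCount (unionFamily g) (i, u) (i + 1, v) *
      leftCount (unionFamily g) (i + 1, v) (i, u) =
      k * (k - 1) * (13 * k - 5) / 6 + (-k) * rankBy (x i) u +
        (-k) * rankBy (x i) u ^ 2 := by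
    intro u
    simp only [hL, h.leftCount_next]
    by_cases hu : u ∈ s
    · simp only [hu, if_true]
      refine (Finset.sum_congr rfl fun v _ => ?_).trans
        ((sum_quadratic_rankBy (h.injective (i + 1))
          ((k + rankBy (x i) u) * (2 * k - 2 - rankBy (x i) u))
          (k - 2 - 2 * rankBy (x i) u) (-1)).trans ?_)
      · ring
      · rw [← hk]; ring
    · simp only [hu, if_false]
      refine (Finset.sum_congr rfl fun v _ => ?_).trans
        ((sum_quadratic_rankBy (h.injective (i + 1))
          ((2 * k - 1 + rankBy (x i) u) * (k - 1 - rankBy (x i) u))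
          (k + 2 * rankBy (x i) u) (-1)).trans ?_)
      · ring
      · rw [← hk]; ring
  simp only [inner]
  rw [sum_quadratic_rankBy (h.injective i), ← hk]
  ring

open Classical in
/-- The number of separated pairs of a union of three clusters of `k` points, `a` points of each of
which are on the lower side of the next cluster. -/
theorem separations_eq (h : ThreeClusters g x s) (hg : ∀ i, GeneralPosition (g i)) {k a : ℚ}
    (hk : Fintype.card W = k) (ha : (∑ w, if w ∈ s then 1 else 0) = a) :
    separations (unionFamily g) =
      ∑ i, (separations (g i) + 2 * (a * upperCount (g i) (x i) +
        (2 * k - a) * (k * (k - 1) / 2 * (k - 2) - upperCount (g i) (x i)) +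
        k * (k - 1) / 2 * (a * (2 * k - a)))) + k ^ 2 * (k - 1) * (11 * k - 7) := by
  set S : Fin 3 → Fin 3 → ℚ := fun i i' => ∑ u, ∑ v,
    leftCount (unionFamily g) (i, u) (i', v) * leftCount (unionFamily g) (i', v) (i, u) with hS
  have htotal : separations (unionFamily g) = ∑ i, ∑ i', S i i' := by
    simp only [separations, Fintype.sum_prod_type, hS]
    exact Finset.sum_congr rfl fun i _ => Finset.sum_comm
  have hsymm : ∀ i i', S i i' = S i' i := by
    intro i i'
    simp only [hS]
    rw [Finset.sum_comm]
    simp only [mul_comm]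
  have hnext : ∀ i, S i (i + 1) = k ^ 2 * (k - 1) * (11 * k - 7) / 6 := by
    intro i
    rw [← hk]
    exact h.sum_next hg i
  have hsame : ∀ i, S i i = separations (g i) + 2 * (a * upperCount (g i) (x i) +
        (2 * k - a) * (k * (k - 1) / 2 * (k - 2) - upperCount (g i) (x i)) +
        k * (k - 1) / 2 * (a * (2 * k - a))) := by
    intro i
    have hC := sum_sum_ite_lt (h.injective i)
    rw [hk] at hC
    have hpair : ∀ u v, (if x i u < x i v then leftCount (unionFamily g) (i, u) (i, v) *
          leftCount (unionFamily g) (i, v) (i, u) else 0) =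
        (if x i u < x i v then leftCount (g i) u v * leftCount (g i) v u else 0) +
        (a - (2 * k - a)) * (if x i u < x i v then leftCount (g i) u v else 0) +
        (2 * k - a) * (k - 2 + a) * (if x i u < x i v then 1 else 0) := by
      intro u v
      by_cases huv : x i u < x i v
      · obtain ⟨h1, h2⟩ := h.leftCount_same i huv
        have h3 := (hg i).leftCount_add (p := u) (q := v) (fun e => by simp [e] at huv)
        rw [hk] at h1 h3
        rw [ha] at h1 h2
        simp only [huv, if_true, h1, h2]
        linear_combination (2 * k - a) * h3
      · simp [huv]
    simp only [hS]
    rw [sum_sum_eq_two_mul (h.injective i) (fun u v => mul_comm _ _) (fun u => by simp),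
      separations, sum_sum_eq_two_mul (h.injective i) (fun u v => mul_comm _ _) (fun u => by simp)]
    simp only [hpair, Finset.sum_add_distrib, ← Finset.mul_sum, hC]
    rw [upperCount]
    ring
  have hrow : ∀ i, ∑ i', S i i' = S i i + k ^ 2 * (k - 1) * (11 * k - 7) / 6 +
      k ^ 2 * (k - 1) * (11 * k - 7) / 6 := by
    intro i
    have hi : i + 2 + 1 = i := by omega
    have := hnext (i + 2)
    rw [hi] at this
    rw [sum_fin_three_rotate (S i) i, hnext, hsymm i (i + 2), this]
  rw [htotal]
  simp only [hrow, hsame, Finset.sum_add_distrib, Finset.sum_const, Finset.card_univ,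
    Fintype.card_fin, nsmul_eq_mul]
  push_cast
  ring

end ThreeClusters

/-! ### Counts for Singer families -/

/-- The clusters of a Singer family in counterclockwise order: left, right, top. -/
def ccwClusters {W : Type*} (f : Fin 3 × W → ℝ × ℝ) (i : Fin 3) (w : W) : ℝ × ℝ :=
  f (Equiv.swap 1 2 i, w)

theorem separations_ccwClusters {W : Type*} [Fintype W] (f : Fin 3 × W → ℝ × ℝ) :
    separations (unionFamily (ccwClusters f)) = separations f :=
  separations_comp_equiv (Equiv.prodCongr (Equiv.swap (1 : Fin 3) 2) (Equiv.refl W)) f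

theorem GeneralPosition.of_ccwClusters {W : Type*} {f : Fin 3 × W → ℝ × ℝ}
    (h : GeneralPosition (unionFamily (ccwClusters f))) : GeneralPosition f := by
  have hinj : Function.Injective fun z : Fin 3 × W => (Equiv.swap 1 2 z.1, z.2) := by
    rintro ⟨i, u⟩ ⟨i', v⟩ h
    simpa using h
  intro u v w huv hvw huw
  have := h _ _ _ (hinj.ne huv) (hinj.ne hvw) (hinj.ne huw)
  simpa [unionFamily, ccwClusters] using this

/-- A Singer family is a union of three clusters none of which is split. The next cluster after the
left one is the right one, which is below it, so that the left cluster has to be read from right to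
left. -/
theorem SingerFamily.threeClusters {j : ℕ} {f : Fin 3 × Word j → ℝ × ℝ}
    (hf : SingerFamily (j + 1) f) :
    ThreeClusters (ccwClusters f) (![fun w => -(f (0, w)).1, fun w => (f (2, w)).1,
      fun w => (f (1, w)).1]) Set.univ := by
  obtain ⟨hs, h01, h12, h012, h0, h2, h1⟩ := hf
  have flip : ∀ {u v w}, orient (f u) (f v) (f w) < 0 → 0 < orient (f v) (f u) (f w) := by
    intro u v w h
    rw [orient_swap]; linarith
  have flip' : ∀ {u v w}, 0 < orient (f u) (f v) (f w) → orient (f v) (f u) (f w) < 0 := by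
    intro u v w h
    rw [orient_swap]; linarith
  refine ⟨fun i => ?_, fun i u v w => ?_, fun i u v huv w => ?_, fun i u v huv w _ => ?_,
    fun i u v huv w hw => absurd (Set.mem_univ w) hw⟩
  · fin_cases i
    · exact neg_injective.comp (hs 0).fst_injective
    · exact (hs 2).fst_injective
    · exact (hs 1).fst_injective
  · fin_cases i
    · exact h012 u v w
    · have := h012 w u v
      rwa [← orient_rotate] at this
    · have := h012 v w u
      rwa [← orient_rotate, ← orient_rotate] at this
  · fin_cases i
    · exact flip (h0.2 v u (neg_lt_neg_iff.1 huv) w)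
    · exact h2.1 u v huv w
    · exact h1.1 u v huv w
  · fin_cases i
    · exact flip' (h0.1 v u (neg_lt_neg_iff.1 huv) w)
    · exact h2.2 u v huv w
    · exact h1.2 u v huv w

theorem SingerFamily.generalPosition {j : ℕ} {f : Word j → ℝ × ℝ} (hf : SingerFamily j f) :
    GeneralPosition f := by
  induction j with
  | zero => exact fun u v _ huv => absurd rfl huv
  | succ j ih =>
    exact GeneralPosition.of_ccwClusters (W := Word j)
      (hf.threeClusters.generalPosition fun i => ih (hf.1 (Equiv.swap 1 2 i)))

theorem SingerFamily.separations_eq {j : ℕ} {f : Word j → ℝ × ℝ} (hf : SingerFamily j f) {k : ℚ}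
    (hk : 3 ^ j = k) :
    separations f = 17 / 78 * k ^ 4 - 5 / 4 * k ^ 3 + 13 / 6 * k ^ 2 - 59 / 52 * k := by
  induction j generalizing k with
  | zero =>
    obtain rfl : k = 1 := by simpa using hk.symm
    have : separations f = 0 :=
      Finset.sum_eq_zero fun u _ => Finset.sum_eq_zero fun v _ => by
        obtain rfl : u = v := rfl
        simp
    rw [this]
    norm_num
  | succ j ih =>
    have hcard : (Fintype.card (Word j) : ℚ) = 3 ^ j := by rw [Word.card]; push_cast; rfl
    have h := hf.threeClusters.separations_eq (fun i => (hf.1 (Equiv.swap 1 2 i)).generalPosition)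
      hcard (a := 3 ^ j) (by simp [hcard])
    have hi : ∀ i, separations (ccwClusters f i) = _ := fun i => ih (hf.1 (Equiv.swap 1 2 i)) rfl
    simp only [hi] at h
    refine (separations_ccwClusters (W := Word j) f).symm.trans (h.trans ?_)
    obtain rfl : k = 3 * 3 ^ j := by rw [← hk, pow_succ, mul_comm]
    rw [Fin.sum_univ_three]
    ring

theorem sum_ite_pos_eq_zero {W : Type*} [Fintype W] {p q : ℝ × ℝ} {a : W → ℝ × ℝ}
    (h : ∀ w, orient p q (a w) < 0) : (∑ w, if 0 < orient p q (a w) then 1 else 0 : ℚ) = 0 :=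
  Finset.sum_eq_zero fun w _ => if_neg (h w).not_gt

theorem sum_ite_pos_eq_card {W : Type*} [Fintype W] {p q : ℝ × ℝ} {a : W → ℝ × ℝ}
    (h : ∀ w, 0 < orient p q (a w)) :
    (∑ w, if 0 < orient p q (a w) then 1 else 0 : ℚ) = Fintype.card W := by
  simp [h]

theorem SingerFamily.upperCount_succ {j : ℕ} {f : Fin 3 × Word j → ℝ × ℝ}
    (hf : SingerFamily (j + 1) f) {k : ℚ} (hk : Fintype.card (Word j) = k) :
    upperCount f (fun z => (f z).1) =
      ∑ i, upperCount (fun w => f (i, w)) (fun w => (f (i, w)).1) +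
        9 / 2 * k ^ 2 * (k - 1) + k ^ 3 := by
  have hinj : ∀ i, Function.Injective fun w => (f (i, w)).1 := fun i => (hf.1 i).fst_injective
  obtain ⟨hs, h01, h12, h012, h0, h2, h1⟩ := hf
  beta_reduce at h01 h12 h012 h0 h2 h1
  have h02 : ∀ u v, (f (0, u)).1 < (f (2, v)).1 := fun u v =>
    (h01 u (Classical.arbitrary _)).trans (h12 _ v)
  have hL : ∀ p q, leftCount f p q =
      (∑ w, if 0 < orient (f p) (f q) (f (0, w)) then 1 else 0) +
      (∑ w, if 0 < orient (f p) (f q) (f (1, w)) then 1 else 0) +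
      (∑ w, if 0 < orient (f p) (f q) (f (2, w)) then 1 else 0) := fun p q =>
    leftCount_unionFamily (fun i w => f (i, w)) p q 0
  set r : Fin 3 → Word j → ℚ := fun i => rankBy fun w => (f (i, w)).1
  have hr1 : ∀ i, ∑ u, r i u = k * (k - 1) / 2 := fun i => by rw [← hk]; exact sum_rankBy (hinj i)
  have hC : ∀ i, (∑ u, ∑ v, if (f (i, u)).1 < (f (i, v)).1 then 1 else 0 : ℚ) =
    k * (k - 1) / 2 := fun i => by rw [← hk]; exact sum_sum_ite_lt (hinj i)
  set S : Fin 3 → Fin 3 → ℚ := fun i i' =>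
    ∑ u, ∑ v, if (f (i, u)).1 < (f (i', v)).1 then leftCount f (i, u) (i', v) else 0 with hS
  have htotal : upperCount f (fun z => (f z).1) = ∑ i, ∑ i', S i i' := by
    simp only [upperCount, Fintype.sum_prod_type, hS]
    exact Finset.sum_congr rfl fun i _ => Finset.sum_comm
  -- pairs in the same cluster: exactly one of the other clusters is above their line
  have hsame : ∀ i, S i i = upperCount (fun w => f (i, w)) (fun w => (f (i, w)).1) +
      k * (k * (k - 1) / 2) := by
    intro i
    rw [← hC i, Finset.mul_sum, upperCount, ← Finset.sum_add_distrib]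
    refine Finset.sum_congr rfl fun u _ => ?_
    rw [Finset.mul_sum, ← Finset.sum_add_distrib]
    refine Finset.sum_congr rfl fun v _ => ?_
    by_cases huv : (f (i, u)).1 < (f (i, v)).1
    · simp only [huv, if_true, mul_one, hL]
      rw [← hk]
      match i with
      | 0 =>
        rw [sum_ite_pos_eq_card (h0.1 u v huv), sum_ite_pos_eq_zero (h0.2 u v huv), leftCount]
        ring
      | 1 =>
        rw [sum_ite_pos_eq_card (h1.1 u v huv), sum_ite_pos_eq_zero (h1.2 u v huv), leftCount]
        ring
      | 2 =>
        rw [sum_ite_pos_eq_card (h2.1 u v huv), sum_ite_pos_eq_zero (h2.2 u v huv), leftCount]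
        ring
    · simp [huv]
  have hsum : ∀ α β γ : ℚ, ∀ i i', ∑ u, ∑ v, (α + β * r i u + γ * r i' v) =
      k * (k * α) + (β + γ) * (k * (k * (k - 1) / 2)) := by
    intro α β γ i i'
    simp only [Finset.sum_add_distrib, ← Finset.mul_sum, hr1, Finset.sum_const, Finset.card_univ,
      nsmul_eq_mul, hk]
    ring
  -- pairs in different clusters: the ranks count the points in the two clusters of the pair
  have h01' : S 0 1 = k ^ 2 * (k - 1) := by
    have : S 0 1 = ∑ u, ∑ v, (k - 1 + 1 * r 0 u + (-1) * r 1 v) := by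
      refine Finset.sum_congr rfl fun u _ => Finset.sum_congr rfl fun v _ => ?_
      rw [if_pos (h01 u v), hL,
        sum_left_of_above (fun u' v' huv => h0.1 u' v' huv v) (hinj 0) u,
        sum_left_to_above (fun u' v' huv => h1.1 u' v' huv u) (hinj 1) v,
        sum_ite_pos_eq_zero fun w => ?_, hk]
      · ring
      · have := h012 u w v
        rw [← orient_rotate, ← orient_rotate, orient_swap] at this
        linarith
    rw [this, hsum]
    ring
  have h02' : S 0 2 = k ^ 2 * (k - 1) + k ^ 3 := by
    have : S 0 2 = ∑ u, ∑ v, (2 * k - 1 + (-1) * r 0 u + 1 * r 2 v) := by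
      refine Finset.sum_congr rfl fun u _ => Finset.sum_congr rfl fun v _ => ?_
      rw [if_pos (h02 u v), hL,
        sum_left_of_below (fun u' v' huv => h0.2 u' v' huv v) (hinj 0) u,
        sum_left_to_below (fun u' v' huv => h2.2 u' v' huv u) (hinj 2) v,
        sum_ite_pos_eq_card fun w => h012 u v w, hk]
      ring
    rw [this, hsum]
    ring
  have h12' : S 1 2 = k ^ 2 * (k - 1) := by
    have : S 1 2 = ∑ u, ∑ v, (2 * k - 2 + (-1) * r 1 u + (-1) * r 2 v) := by
      refine Finset.sum_congr rfl fun u _ => Finset.sum_congr rfl fun v _ => ?_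
      rw [if_pos (h12 u v), hL,
        sum_left_of_below (fun u' v' huv => h1.2 u' v' huv v) (hinj 1) u,
        sum_left_to_above (fun u' v' huv => h2.1 u' v' huv u) (hinj 2) v,
        sum_ite_pos_eq_zero fun w => ?_, hk]
      · ring
      · have := h012 w v u
        rw [← orient_rotate, orient_swap] at this
        linarith
    rw [this, hsum]
    ring
  have hzero : ∀ i i', (∀ u v, (f (i', u)).1 < (f (i, v)).1) → S i i' = 0 := fun i i' h =>
    Finset.sum_eq_zero fun u _ => Finset.sum_eq_zero fun v _ => if_neg (h v u).not_gt
  rw [htotal]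
  simp only [Fin.sum_univ_three, hsame, h01', h02', h12', hzero 1 0 h01, hzero 2 0 h02,
    hzero 2 1 h12]
  ring

theorem SingerFamily.upperCount_eq {j : ℕ} {f : Word j → ℝ × ℝ} (hf : SingerFamily j f) {k : ℚ}
    (hk : 3 ^ j = k) :
    upperCount f (fun w => (f w).1) = 11 / 48 * k ^ 3 - 3 / 4 * k ^ 2 + 25 / 48 * k := by
  induction j generalizing k with
  | zero =>
    obtain rfl : k = 1 := by simpa using hk.symm
    have : upperCount f (fun w => (f w).1) = 0 :=
      Finset.sum_eq_zero fun u _ => Finset.sum_eq_zero fun v _ => by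
        obtain rfl : u = v := rfl
        simp
    rw [this]
    norm_num
  | succ j ih =>
    have hcard : (Fintype.card (Word j) : ℚ) = 3 ^ j := by rw [Word.card]; push_cast; rfl
    refine (hf.upperCount_succ hcard).trans ?_
    have hi : ∀ i : Fin 3, upperCount (fun w => f (i, w)) (fun w => (f (i, w)).1) = _ :=
      fun i => ih (hf.1 i) rfl
    simp only [hi]
    obtain rfl : k = 3 * 3 ^ j := by rw [← hk, pow_succ, mul_comm]
    rw [Fin.sum_univ_three]
    ring

/-! ### Slid families -/

/-- A parametrized slid configuration: three clusters `f i`, each of which is a Singer family in its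
frame `φ i`, has the next cluster on its upper side, and splits the third one into the part
indexed by `s` on its lower side and the rest on its upper side. -/
structure SlidFamily (j : ℕ) (s : Set (Word j)) (φ : Fin 3 → (ℝ × ℝ) ≃ᵃ[ℝ] (ℝ × ℝ))
    (f : Fin 3 → Word j → ℝ × ℝ) : Prop where
  ccw : ∀ u v w, 0 < orient (f 0 u) (f 1 v) (f 2 w)
  singer : ∀ i, SingerFamily j fun w => φ i (f i w)
  next : ∀ i, FamilyAbove (fun w => φ i (f i w)) fun w => φ i (f (i + 1) w)
  right : ∀ i, FamilyBelow (fun w => φ i (f i w)) fun w : s => φ i (f (i + 2) w)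
  left : ∀ i, FamilyAbove (fun w => φ i (f i w)) fun w : (sᶜ : Set (Word j)) => φ i (f (i + 2) w)

/-- The map `φ` multiplies all orientations by a positive constant. -/
def PreservesOrientation (φ : ℝ × ℝ → ℝ × ℝ) : Prop :=
  ∃ c : ℝ, 0 < c ∧ ∀ p q r, orient (φ p) (φ q) (φ r) = c * orient p q r

namespace PreservesOrientation

variable {φ : ℝ × ℝ → ℝ × ℝ}

theorem orient_pos_iff (h : PreservesOrientation φ) (p q r : ℝ × ℝ) :
    0 < orient (φ p) (φ q) (φ r) ↔ 0 < orient p q r := by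
  obtain ⟨c, hc, h⟩ := h
  rw [h, mul_pos_iff_of_pos_left hc]

theorem orient_neg_iff (h : PreservesOrientation φ) (p q r : ℝ × ℝ) :
    orient (φ p) (φ q) (φ r) < 0 ↔ orient p q r < 0 := by
  obtain ⟨c, hc, h⟩ := h
  rw [h, ← neg_pos, ← mul_neg, mul_pos_iff_of_pos_left hc, neg_pos]

theorem generalPosition {ι : Type*} {f : ι → ℝ × ℝ} (h : PreservesOrientation φ)
    (hf : GeneralPosition fun w => φ (f w)) : GeneralPosition f := by
  obtain ⟨c, hc, h⟩ := h
  intro u v w huv hvw huw h0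
  exact hf u v w huv hvw huw (by rw [h, h0, mul_zero])

theorem leftCount_eq {ι : Type*} [Fintype ι] (h : PreservesOrientation φ) (f : ι → ℝ × ℝ)
    (p q : ι) : leftCount (fun w => φ (f w)) p q = leftCount f p q := by
  simp only [leftCount, h.orient_pos_iff]

end PreservesOrientation

namespace SlidFamily

variable {j : ℕ} {s : Set (Word j)} {φ : Fin 3 → (ℝ × ℝ) ≃ᵃ[ℝ] (ℝ × ℝ)}
  {f : Fin 3 → Word j → ℝ × ℝ}

theorem threeClusters (h : SlidFamily j s φ f) (hφ : ∀ i, PreservesOrientation (φ i)) :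
    ThreeClusters f (fun i w => (φ i (f i w)).1) s where
  injective i := (h.singer i).fst_injective
  ccw i u v w := by
    match i with
    | 0 => exact h.ccw u v w
    | 1 => have := h.ccw w u v; rwa [← orient_rotate] at this
    | 2 => have := h.ccw v w u; rwa [← orient_rotate, ← orient_rotate] at this
  next i u v huv w := ((hφ i).orient_pos_iff _ _ _).1 (h.next i u v huv w)
  right i u v huv w hw := ((hφ i).orient_neg_iff _ _ _).1 (h.right i u v huv ⟨w, hw⟩)
  left i u v huv w hw := ((hφ i).orient_pos_iff _ _ _).1 (h.left i u v huv ⟨w, hw⟩)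

theorem isSlidSinger (h : SlidFamily j s φ f) : IsSlidSinger j s.ncard (⋃ i, Set.range (f i)) := by
  have himg : ∀ i i' (t : Set (Word j)),
      φ i '' (f i' '' t) = Set.range fun w : t => φ i (f i' w) := by
    intro i i' t
    rw [Set.image_image, Set.image_eq_range]
  have hrange : ∀ i i', φ i '' Set.range (f i') = Set.range fun w => φ i (f i' w) := fun i i' =>
    (Set.range_comp (φ i) (f i')).symm
  have hinj : ∀ i, Function.Injective (f i) := fun i u v huv =>
    (h.singer i).fst_injective (by simp only [huv])
  have hi : ∀ i : Fin 3, i + 1 + 1 = i + 2 ∧ i + 1 + 2 = i := fun i => by omega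
  refine ⟨fun i => Set.range (f i), fun i => f i '' s, fun i => f i '' sᶜ, φ, rfl, ?_,
    fun i => ⟨?_, ?_, ?_, ?_, ?_, ?_, ?_⟩⟩
  · rintro _ ⟨u, rfl⟩ _ ⟨v, rfl⟩ _ ⟨w, rfl⟩
    exact h.ccw u v w
  · rw [hrange]
    exact (h.singer i).isSinger
  · rw [← Set.image_union, Set.union_compl_self, Set.image_univ]
  · rw [Set.disjoint_image_iff (hinj i)]
    exact disjoint_compl_right
  · exact Set.ncard_image_of_injective s (hinj i)
  · rw [hrange, hrange]
    have := (h.next (i + 1)).docksAbove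
    rwa [(hi i).1] at this
  · rw [hrange, himg]
    have := (h.left (i + 1)).docksAbove
    rwa [(hi i).2] at this
  · rw [hrange, himg]
    have := (h.right (i + 1)).docksBelow
    rwa [(hi i).2] at this

open Filter Topology in
theorem eventually {Y : Type*} {l : Filter Y} {p : Y → Fin 3 → Word j → ℝ × ℝ}
    (hp : ∀ i u, Tendsto (fun y => p y i u) l (𝓝 (f i u))) (h : SlidFamily j s φ f) :
    ∀ᶠ y in l, SlidFamily j s φ (p y) := by
  have hφ : ∀ i i' u, Tendsto (fun y => φ i (p y i' u)) l (𝓝 (φ i (f i' u))) := fun i i' u =>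
    (((φ i).toAffineMap.continuous_of_finiteDimensional).tendsto _).comp (hp i' u)
  have h1 : ∀ᶠ y in l, ∀ u v w, 0 < orient (p y 0 u) (p y 1 v) (p y 2 w) :=
    eventually_all.2 fun u => eventually_all.2 fun v => eventually_all.2 fun w =>
      (tendsto_orient (hp 0 u) (hp 1 v) (hp 2 w)).eventually_const_lt (h.ccw u v w)
  have h2 := eventually_all.2 fun i => (h.singer i).eventually (hφ i i)
  have h3 := eventually_all.2 fun i =>
    (h.next i).eventually (hφ i i) (hφ i (i + 1)) (h.singer i).fst_injective
  have h4 := eventually_all.2 fun i =>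
    (h.right i).eventually (hφ i i) (fun w : s => hφ i (i + 2) w) (h.singer i).fst_injective
  have h5 := eventually_all.2 fun i =>
    (h.left i).eventually (hφ i i)
      (fun w : (sᶜ : Set (Word j)) => hφ i (i + 2) w) (h.singer i).fst_injective
  filter_upwards [h1, h2, h3, h4, h5] with y h1 h2 h3 h4 h5 using ⟨h1, h2, h3, h4, h5⟩

/-- The number of separated pairs of a slid configuration, in the form in which it enters the number
of crossings. -/
theorem separations_eq (h : SlidFamily j s φ f) (hφ : ∀ i, PreservesOrientation (φ i)) {n k a : ℚ}
    (hk : 3 ^ j = k) (hn : n = 3 * k) (ha : s.ncard = a) :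
    n * (n - 1) * (n - 2) * (n - 3) - 4 * separations (unionFamily f) = 8 * Cs3 n a := by
  classical
  have hcard : (Fintype.card (Word j) : ℚ) = k := by rw [Word.card, ← hk]; push_cast; rfl
  have ha' : (∑ w, if w ∈ s then 1 else 0 : ℚ) = a := by
    rw [← ha, Set.ncard_eq_toFinset_card', Finset.sum_boole]
    congr 2
    ext w
    simp
  have hsep : ∀ i, separations (f i) = _ := fun i => by
    have := (h.singer i).separations_eq hk
    simp only [separations, (hφ i).leftCount_eq] at this
    exact this
  have hup : ∀ i, upperCount (f i) (fun w => (φ i (f i w)).1) = _ := fun i => by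
    have := (h.singer i).upperCount_eq hk
    simp only [upperCount, (hφ i).leftCount_eq] at this
    exact this
  rw [(h.threeClusters hφ).separations_eq
    (fun i => (hφ i).generalPosition (h.singer i).generalPosition) hcard ha']
  simp only [hsep, hup, Fin.sum_univ_three]
  rw [Cs3, hn]
  ring

end SlidFamily

/-! ### Existence of slid families -/

/-- The orientation preserving affine map with linear part `(p₁, p₂) ↦ (a p₁ + b p₂, c p₁ + d p₂)`
and translation part `(x, y)`. -/
noncomputable def planeAffineEquiv (x y a b c d : ℝ) (h : 0 < a * d - b * c) :
    (ℝ × ℝ) ≃ᵃ[ℝ] (ℝ × ℝ) where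
  toFun p := (x + a * p.1 + b * p.2, y + c * p.1 + d * p.2)
  invFun p := ((a * d - b * c)⁻¹ * (d * (p.1 - x) - b * (p.2 - y)),
    (a * d - b * c)⁻¹ * (a * (p.2 - y) - c * (p.1 - x)))
  left_inv p := by
    have := mul_inv_cancel₀ h.ne'
    ext
    · linear_combination p.1 * this
    · linear_combination p.2 * this
  right_inv p := by
    have := mul_inv_cancel₀ h.ne'
    ext
    · linear_combination (p.1 - x) * this
    · linear_combination (p.2 - y) * this
  linear :=
    { toFun := fun p => (a * p.1 + b * p.2, c * p.1 + d * p.2)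
      invFun := fun p => ((a * d - b * c)⁻¹ * (d * p.1 - b * p.2),
        (a * d - b * c)⁻¹ * (a * p.2 - c * p.1))
      map_add' := fun p q => by ext <;> simp <;> ring
      map_smul' := fun r p => by ext <;> simp <;> ring
      left_inv := fun p => by
        have := mul_inv_cancel₀ h.ne'
        ext
        · linear_combination p.1 * this
        · linear_combination p.2 * this
      right_inv := fun p => by
        have := mul_inv_cancel₀ h.ne'
        ext
        · linear_combination p.1 * this
        · linear_combination p.2 * this }
  map_vadd' p v := by ext <;> simp <;> ring

theorem planeAffineEquiv_apply (x y a b c d : ℝ) (h : 0 < a * d - b * c) (p : ℝ × ℝ) :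
    planeAffineEquiv x y a b c d h p = (x + a * p.1 + b * p.2, y + c * p.1 + d * p.2) := rfl

theorem preservesOrientation_planeAffineEquiv {x y a b c d : ℝ} (h : 0 < a * d - b * c) :
    PreservesOrientation (planeAffineEquiv x y a b c d h) := by
  refine ⟨a * d - b * c, h, fun p q r => ?_⟩
  simp only [planeAffineEquiv_apply, orient]
  ring

/-- Three flat clusters at the corners `(0, 0)`, `(1, 0)`, `(0, 1)` of a triangle. The map
`(x, y) ↦ (1 - x - y, x)` permutes the corners cyclically, and it maps each cluster to the next
one. The lines of the cluster at `(0, 0)` are almost vertical. At height `1` they are within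
`O(ε ^ 2)` of the vertical axis, whereas the points of the third cluster have abscissa `-ε x` there,
up to higher order; so the lines separate the points with `x > 0` from those with `x < 0`. -/
def slidPoint (ε : ℝ) (i : Fin 3) (p : ℝ × ℝ) : ℝ × ℝ :=
  ![(ε ^ 3 * p.2, -(ε * p.1)), (1 - ε ^ 3 * p.2 + ε * p.1, ε ^ 3 * p.2),
    (-(ε * p.1), 1 - ε ^ 3 * p.2 + ε * p.1)] i

open Filter Topology in
/-- The slid configuration made of three flat copies of a Singer family. Since the copies are
permuted by an affine map, the other two clusters look the same from all three frames, and only two docking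
conditions have to be checked; they hold in the limit of thin copies. -/
theorem exists_slidFamily_of_fst_ne_zero {j : ℕ} {f : Word j → ℝ × ℝ} (hf : SingerFamily j f)
    (h0 : ∀ w, (f w).1 ≠ 0) :
    ∃ φ g, SlidFamily j {w | 0 < (f w).1} φ g ∧ ∀ i, PreservesOrientation (φ i) := by
  -- the next and the third cluster as seen from the frame of a cluster
  let top : ℝ → Word j → ℝ × ℝ := fun ε w =>
    (-(ε ^ 2 * (f w).2), (1 - ε ^ 3 * (f w).2 + ε * (f w).1) / ε ^ 3)
  let third : ℝ → Word j → ℝ × ℝ := fun ε w =>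
    (-((1 - ε ^ 3 * (f w).2 + ε * (f w).1) / ε), -((f w).1 / ε ^ 2))
  have htop : ∀ᶠ ε in 𝓝[>] (0 : ℝ), FamilyAbove f (top ε) := by
    refine eventually_all.2 fun u => eventually_all.2 fun v => ?_
    by_cases huv : (f u).1 < (f v).1
    swap
    · exact Eventually.of_forall fun ε h => absurd h huv
    refine (eventually_all.2 fun w => ?_).mono fun ε h _ => h
    have hlim : Tendsto (fun ε : ℝ => ((f v).1 - (f u).1) *
        (1 - ε ^ 3 * (f w).2 + ε * (f w).1 - ε ^ 3 * (f u).2) -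
        ε ^ 3 * ((f v).2 - (f u).2) * (-(ε ^ 2 * (f w).2) - (f u).1)) (𝓝[>] 0)
        (𝓝 ((f v).1 - (f u).1)) := by
      refine Tendsto.mono_left ?_ nhdsWithin_le_nhds
      refine (Continuous.tendsto' (by fun_prop) _ _ (by simp))
    filter_upwards [hlim.eventually_const_lt (sub_pos.2 huv), self_mem_nhdsWithin] with ε h hε
    have hε' : (0 : ℝ) < ε := hε
    refine (mul_pos_iff_of_pos_left (pow_pos hε' 3)).1 (h.trans_eq ?_)
    simp only [orient, top]
    field_simp
  have hthird : ∀ᶠ ε in 𝓝[>] (0 : ℝ), ∀ u v, (f u).1 < (f v).1 → ∀ w,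
      0 < orient (f u) (f v) (third ε w) * -(f w).1 := by
    refine eventually_all.2 fun u => eventually_all.2 fun v => ?_
    by_cases huv : (f u).1 < (f v).1
    swap
    · exact Eventually.of_forall fun ε h => absurd h huv
    refine (eventually_all.2 fun w => ?_).mono fun ε h _ => h
    have hlim : Tendsto (fun ε : ℝ => (((f v).1 - (f u).1) * (-(f w).1 - ε ^ 2 * (f u).2) -
        ((f v).2 - (f u).2) * (-(ε * (1 - ε ^ 3 * (f w).2 + ε * (f w).1)) - ε ^ 2 * (f u).1)) *
          -(f w).1) (𝓝[>] 0) (𝓝 (((f v).1 - (f u).1) * (f w).1 ^ 2)) := by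
      refine Tendsto.mono_left ?_ nhdsWithin_le_nhds
      refine (Continuous.tendsto' (by fun_prop) _ _ (by simp; ring))
    filter_upwards [hlim.eventually_const_lt
      (mul_pos (sub_pos.2 huv) (pow_two_pos_of_ne_zero (h0 w))), self_mem_nhdsWithin] with ε h hε
    have hε' : (0 : ℝ) < ε := hε
    refine (mul_pos_iff_of_pos_left (pow_pos hε' 2)).1 (h.trans_eq ?_)
    simp only [orient, third]
    field_simp
  have htend : ∀ i w, Tendsto (fun ε => slidPoint ε i (f w)) (𝓝[>] 0)
      (𝓝 (![(0, 0), (1, 0), (0, 1)] i)) := by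
    intro i w
    refine Tendsto.mono_left ?_ nhdsWithin_le_nhds
    match i with
    | 0 | 1 | 2 =>
      exact Continuous.tendsto' (by simp only [slidPoint, Matrix.cons_val]; fun_prop) _ _
        (by simp [slidPoint])
  have hccw : ∀ᶠ ε in 𝓝[>] (0 : ℝ), ∀ u v w,
      0 < orient (slidPoint ε 0 (f u)) (slidPoint ε 1 (f v)) (slidPoint ε 2 (f w)) :=
    eventually_all.2 fun u => eventually_all.2 fun v => eventually_all.2 fun w =>
      (tendsto_orient (htend 0 u) (htend 1 v) (htend 2 w)).eventually_const_lt (by simp [orient])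
  obtain ⟨ε, h1, h3, hc, hε⟩ := (htop.and (hthird.and (hccw.and self_mem_nhdsWithin))).exists
  have hε' : (0 : ℝ) < ε := hε
  have hdet : 0 < 1 / ε * (1 / ε ^ 3) := by positivity
  -- the inverses of the maps `slidPoint ε i`
  let φ : Fin 3 → (ℝ × ℝ) ≃ᵃ[ℝ] (ℝ × ℝ) := ![
    planeAffineEquiv 0 0 0 (-(1 / ε)) (1 / ε ^ 3) 0 (by linarith),
    planeAffineEquiv (-(1 / ε)) 0 (1 / ε) (1 / ε) 0 (1 / ε ^ 3) (by linarith),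
    planeAffineEquiv 0 (1 / ε ^ 3) (-(1 / ε)) 0 (-(1 / ε ^ 3)) (-(1 / ε ^ 3)) (by linarith)]
  have hφ : ∀ i p, φ i (slidPoint ε i p) = p := by
    intro i p
    match i with
    | 0 => ext <;> simp [φ, planeAffineEquiv_apply, slidPoint] <;> field_simp
    | 1 => ext <;> simp [φ, planeAffineEquiv_apply, slidPoint] <;> field_simp <;> ring
    | 2 => ext <;> simp [φ, planeAffineEquiv_apply, slidPoint] <;> field_simp <;> ring
  have hφ1 : ∀ i w, φ i (slidPoint ε (i + 1) (f w)) = top ε w := by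
    intro i w
    match i with
    | 0 => ext <;> simp [φ, planeAffineEquiv_apply, slidPoint, top] <;> field_simp
    | 1 => ext <;> simp [φ, planeAffineEquiv_apply, slidPoint, top] <;> field_simp <;> ring
    | 2 => ext <;> simp [φ, planeAffineEquiv_apply, slidPoint, top] <;> field_simp <;> ring
  have hφ2 : ∀ i w, φ i (slidPoint ε (i + 2) (f w)) = third ε w := by
    intro i w
    match i with
    | 0 => ext <;> simp [φ, planeAffineEquiv_apply, slidPoint, third] <;> field_simp
    | 1 => ext <;> simp [φ, planeAffineEquiv_apply, slidPoint, third] <;> field_simp <;> ring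
    | 2 => ext <;> simp [φ, planeAffineEquiv_apply, slidPoint, third] <;> field_simp <;> ring
  refine ⟨φ, fun i w => slidPoint ε i (f w), ⟨hc, fun i => ?_, fun i => ?_, fun i => ?_,
    fun i => ?_⟩, fun i => ?_⟩
  · simpa only [hφ] using hf
  · simpa only [hφ, hφ1] using h1
  · simp only [hφ, hφ2]
    intro u v huv w
    have hw : 0 < (f w).1 := w.2
    nlinarith [h3 u v huv w]
  · simp only [hφ, hφ2]
    intro u v huv w
    have hw : (f w).1 < 0 := lt_of_le_of_ne (not_lt.1 w.2) (h0 w)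
    nlinarith [h3 u v huv w]
  · match i with
    | 0 => exact preservesOrientation_planeAffineEquiv (by linarith)
    | 1 => exact preservesOrientation_planeAffineEquiv (by linarith)
    | 2 => exact preservesOrientation_planeAffineEquiv (by linarith)

/-- Injective functions have upper level sets of every size, at levels that are not attained. -/
theorem exists_threshold {W : Type*} [Fintype W] {x : W → ℝ} (hx : Function.Injective x) {a : ℕ}
    (ha : a ≤ Fintype.card W) : ∃ t, (∀ w, x w ≠ t) ∧ {w | t < x w}.ncard = a := by
  classical
  set k := Fintype.card W with hk
  let hi : Finset W := Finset.univ.filter fun w => ((k - a : ℕ) : ℚ) ≤ rankBy x w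
  have hcard : hi.card = a := by
    have h1 := sum_comp_rankBy hx fun r => if ((k - a : ℕ) : ℚ) ≤ r then 1 else 0
    rw [Finset.sum_boole, Finset.sum_boole] at h1
    have h2 : (Finset.range k).filter (fun r : ℕ => ((k - a : ℕ) : ℚ) ≤ r) =
        Finset.Ico (k - a) k := by
      ext r
      simp only [Finset.mem_filter, Finset.mem_range, Finset.mem_Ico, Nat.cast_le]
      exact and_comm
    rw [← hk, h2, Nat.card_Ico] at h1
    have h3 : hi.card = k - (k - a) := by exact_mod_cast h1
    omega
  have hmono : ∀ y z, x y ≤ x z → rankBy x y ≤ rankBy x z := by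
    intro y z hyz
    refine Finset.sum_le_sum fun w _ => ?_
    by_cases h : x w < x y
    · simp [h, h.trans_le hyz]
    · rw [if_neg h]
      split_ifs <;> norm_num
  obtain ⟨t, hlo, hhi⟩ := Order.exists_between_finsets (hiᶜ.image x) (hi.image x) (by
    simp only [Finset.mem_image, Finset.mem_compl]
    rintro _ ⟨y, hy, rfl⟩ _ ⟨z, hz, rfl⟩
    by_contra! hcon
    simp only [hi, Finset.mem_filter, Finset.mem_univ, true_and] at hy hz
    exact hy (hz.trans (hmono z y hcon)))
  have hlo' : ∀ w, w ∉ hi → x w < t := fun w hw =>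
    hlo _ (Finset.mem_image_of_mem x (Finset.mem_compl.2 hw))
  have hhi' : ∀ w, w ∈ hi → t < x w := fun w hw => hhi _ (Finset.mem_image_of_mem x hw)
  refine ⟨t, fun w => ?_, ?_⟩
  · by_cases hw : w ∈ hi
    · exact (hhi' w hw).ne'
    · exact (hlo' w hw).ne
  · rw [← hcard, ← Set.ncard_coe_finset]
    congr 1
    ext w
    refine ⟨fun h => ?_, hhi' w⟩
    by_contra hw
    exact lt_asymm h (hlo' w hw)

theorem exists_slidFamily {j a : ℕ} (ha : a ≤ 3 ^ j) :
    ∃ s φ f, SlidFamily j s φ f ∧ (∀ i, PreservesOrientation (φ i)) ∧ s.ncard = a := by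
  obtain ⟨f, hf⟩ := exists_singerFamily j
  obtain ⟨t, ht, hcard⟩ := exists_threshold hf.fst_injective (ha.trans_eq (Word.card j).symm)
  have hf' := hf.shear one_pos one_pos (-t) 0 0
  obtain ⟨φ, g, hg, hφ⟩ := exists_slidFamily_of_fst_ne_zero hf' fun w h => ht w (by linarith)
  refine ⟨_, φ, g, hg, hφ, hcard ▸ congrArg Set.ncard ?_⟩
  ext w
  show 0 < -t + 1 * (f w).1 ↔ t < (f w).1
  constructor <;> intro h <;> linarith

/-- There is a rectilinear drawing whose vertices form a slid configuration: a slid family can be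
perturbed so that no three edges are concurrent. -/
theorem exists_drawing_isSlidSinger {j a : ℕ} (ha : a ≤ 3 ^ j) :
    ∃ D : RectilinearDrawing (3 ^ (j + 1)), IsSlidSinger j a (Set.range D.pt) ∧
      (D.crossings : ℚ) = Cs3 ((3 ^ (j + 1) : ℕ) : ℚ) a := by
  obtain ⟨s, φ, f₀, hf₀, hφ, hs⟩ := exists_slidFamily ha
  have hev : ∀ᶠ y in nhds (unionFamily f₀), SlidFamily j s φ fun i w => y (i, w) :=
    hf₀.eventually fun i w => (continuous_apply (i, w)).tendsto (unionFamily f₀)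
  obtain ⟨y, hy, hcon⟩ := exists_not_concurrent (unionFamily f₀) hev
  have hcard : Fintype.card (Fin 3 × Word j) = 3 ^ (j + 1) := by
    rw [Fintype.card_prod, Fintype.card_fin, Word.card, pow_succ, mul_comm]
  let e : Fin (3 ^ (j + 1)) ≃ Fin 3 × Word j := (Fintype.equivFinOfCardEq hcard).symm
  have hgen : GeneralPosition y := (hy.threeClusters hφ).generalPosition fun i =>
    (hφ i).generalPosition (hy.singer i).generalPosition
  have hinj : Function.Injective y := hgen.injective <| by
    rw [hcard, pow_succ]
    have := Nat.one_le_pow j 3 (by norm_num)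
    omega
  have hgen' : GeneralPosition (y ∘ e) := fun u v w huv hvw huw =>
    hgen _ _ _ (e.injective.ne huv) (e.injective.ne hvw) (e.injective.ne huw)
  refine ⟨hgen'.drawing (hinj.comp e.injective) fun g => hcon (g.trans e.toEmbedding), ?_, ?_⟩
  · have h := hy.isSlidSinger
    rw [hs] at h
    have hrange : Set.range (y ∘ e) = ⋃ i, Set.range fun w => y (i, w) := by
      rw [e.surjective.range_comp]
      exact range_word_succ y
    exact hrange ▸ h
  · have h1 := (hgen'.drawing (hinj.comp e.injective)
      fun g => hcon (g.trans e.toEmbedding)).crossings_eq hgen'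
    have h2 := hy.separations_eq hφ rfl (n := ((3 ^ (j + 1) : ℕ) : ℚ))
      (by push_cast; ring) (congrArg Nat.cast hs)
    have h3 : separations (hgen'.drawing (hinj.comp e.injective)
      fun g => hcon (g.trans e.toEmbedding)).pt = separations y := separations_comp_equiv e y
    have h4 : separations (unionFamily fun i w => y (i, w)) = separations y := rfl
    rw [h3] at h1
    rw [h4] at h2
    linarith

theorem mainTheorem2 :
    (∀ i n a : ℕ, 1 ≤ i → n = 3 ^ i → a = ⌈(23 * n : ℚ) / 72 - 1 / 24⌉₊ →
      (∃ D : RectilinearDrawing n,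
        IsSlidSinger (i - 1) a (Set.range D.pt) ∧ (D.crossings : ℚ) = Cs3 n a) ∧
      (rectilinearCrossingNumber n : ℚ) ≤ Cs3 n a) ∧
    Cs3 81 26 = 623916 ∧
    rectilinearCrossingNumber 81 ≤ 623916 := by
  have main : ∀ i n a : ℕ, 1 ≤ i → n = 3 ^ i → a = ⌈(23 * n : ℚ) / 72 - 1 / 24⌉₊ →
      (∃ D : RectilinearDrawing n,
        IsSlidSinger (i - 1) a (Set.range D.pt) ∧ (D.crossings : ℚ) = Cs3 n a) ∧
      (rectilinearCrossingNumber n : ℚ) ≤ Cs3 n a := by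
    rintro i n a hi rfl ha
    obtain ⟨j, rfl⟩ := Nat.exists_eq_add_of_le' hi
    have ha' : a ≤ 3 ^ j := by
      rw [ha, Nat.ceil_le]
      have : (0 : ℚ) < 3 ^ j := by positivity
      push_cast
      rw [pow_succ]
      linarith
    obtain ⟨D, hD, hcr⟩ := exists_drawing_isSlidSinger ha'
    refine ⟨⟨D, hD, hcr⟩, ?_⟩
    rw [← hcr]
    exact_mod_cast Nat.sInf_le (Set.mem_range_self D)
  have hval : Cs3 81 26 = 623916 := by norm_num [Cs3]
  refine ⟨main, hval, ?_⟩
  have hceil : 26 = ⌈(23 * (81 : ℕ) : ℚ) / 72 - 1 / 24⌉₊ := by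
    symm
    rw [Nat.ceil_eq_iff (by norm_num)]
    norm_num
  have h := (main 4 81 26 (by norm_num) (by norm_num) hceil).2
  push_cast at h
  rw [hval] at h
  exact_mod_cast h
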